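/- **Setting.** Let $n,m\in\mathbb N$, $N\ge 1$, $A\in\mathbb R^{n\times n}$, $B\in\mathbb R^{n\times m}$ with $(A,B)$ stabilizable, $Q\succ0$, $R\succ0$ symmetric, and let $\mathcal U\subseteq\mathbb R^m$ be closed and convex with $0$ in its interior. Let $P\succeq0$ be the solution of the discrete-time algebraic Riccati equation $P=Q+K^\top RK+(A-BK)^\top P(A-BK)$, $K=(R+B^\top PB)^{-1}B^\top PA$. Write $\|x\|_Q^2=x^\top Qx$; vectors carry the Euclidean norm and matrices the spectral norm; $\lambda^{\pm}(\cdot)$ are extreme eigenvalues and $\lambda^+_M(W)$ is the largest eigenvalue of $M^{-1/2}WM^{-1/2}$. For an input sequence $u$ and $x_{k+1}=Ax_k+Bu_k$, put $J_T(x_0,u)=\|x_T\|_P^2+\sum_{k=0}^{T-1}(\|x_k\|_Q^2+\|u_k\|_R^2)$. *Optimal MPC.* Let $\mathcal N=\mathcal U^N\subseteq\mathbb R^{Nm}$, $\mu^\star(x)=\arg\min_{\nu\in\mathcal N}J_N(x,\nu)$, $\psi(x)=\sqrt{J_N(x,\mu^\star(x))}$, and write $J_N(x,\nu)=x^\top Wx+2\nu^\top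 Gx+\nu^\top H\nu$. With $S=[I\;0\cdots0]$ and $\overline B=BS$, optimal MPC is $x^\star_{k+1}=f(x^\star_k):=Ax^\star_k+\overline B\mu^\star(x^\star_k)$, $x_0^\star=x_0$. Let $c>0$ be such that $\|x\|_P^2\le c$ implies $-Kx\in\mathcal U$; let $r_N=\sqrt{Nc\,\lambda^-(Q)/\lambda^+(P)+c}$ and $\Gamma_N=\{x:\psi(x)\le r_N\}$. A decay rate is a number $\beta\in(0,1)$ with $\psi(f(x))\le\beta\psi(x)$ for all $x\in\Gamma_N$. *Time-distributed MPC.* Let $\mathcal T(x,\nu)=\Pi_{\mathcal N}[\nu-\alpha\nabla_\nu J_N(x,\nu)]$, $\alpha=1/(\lambda^+(H)+\lambda^-(H))$, $\eta=(\lambda^+(H)-\lambda^-(H))/(\lambda^+(H)+\lambda^-(H))$. Given iteration numbers $\ell_k\in\mathbb N$, the scheme is $u_k=\mathcal T^{\ell_k}(x_k,u_{k-1})$, $x_{k+1}=Ax_k+\overline Bu_k$, $u_{-1}=0$. Its suboptimality gap $\mathcal R_T(x_0)$ is the cost $J_T$ of $(Su_k)_k$ minus the cost $J_T$ of $(S\mu^\star(x_k^\star))_k$,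 both from $x_0$. Let $L=\|H^{-1/2}\|\,\|H^{-1/2}G\|$, $\sigma=\|W^{1/2}\overline B\|$, $\omega=1+\|H^{-1/2}\|\,\|H^{-1/2}G\overline B\|$, $$\kappa=\|H^{-1/2}\|\,\|H^{-1/2}G(A-I)P^{-1/2}\|+\|H^{-1/2}\|\sqrt{\lambda_H^+\big((G\overline B)^\top H^{-1}G\overline B\big)\,(\lambda_P^+(W)-1)},$$ $$\ell^\star=\frac{\log(1-\beta)-\log(\sigma\kappa+\omega(1-\beta))}{\log\eta}\quad(\ell^\star=0\text{ if }\eta=0),$$ $$\Sigma_N=\{(x,z)\in\Gamma_N\times\mathcal N:\ \|z-\mu^\star(x)\|\le(1-\beta)r_N/\sigma\}$$ (if $\sigma=0$, i.e. $B=0$, the last condition is read as $z=\mu^\star(x)$). For a horizon $T\ge1$ let $\tilde\eta_{\ell,T-1}=\eta^{\ell_{T-1}}$, $\tilde\eta_{\ell,k}=\eta^{\ell_k}(1+\tilde\eta_{\ell,k+1})$ for $0\le k\le T-2$, $\tilde\eta_\ell=(\tilde\eta_{\ell,1},\dots,\tilde\eta_{\ell,T-1})$, $\bar\eta_\ell=\|\tilde\eta_\ell\|$,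 $\Delta=(\|x_k-x_{k-1}\|)_{k=1}^{T-1}$ and $\delta u_0=u_{-1}-\mu^\star(x_0)=-\mu^\star(x_0)$. *Constants.* The benchmark is exponentially incrementally input-to-state stable (E-$\delta$-ISS) in $\Gamma_N$ with constants $c_0,c_w,r_w>0$, $\rho\in(0,1)$ if $f(\Gamma_N)\subseteq\Gamma_N$ and, whenever $x_{k+1}=f(x_k)$, $y_{k+1}=f(y_k)+w_k$ with $x_0\in\Gamma_N$, all $y_k\in\Gamma_N$ and all $\|w_k\|\le r_w$, one has $\|x_k-y_k\|\le c_0\rho^k\|x_0-y_0\|+c_w\sum_{i=0}^{k-1}\rho^{k-i-1}\|w_i\|$ for all $k$. Call $(c_0,c_w,r_w,\rho,M_x,M_u)$ admissible if E-$\delta$-ISS holds with $(c_0,c_w,r_w,\rho)$, if $\|\overline B(z-\mu^\star(x))\|\le r_w$ on $\Sigma_N$, and if $M_x,M_u>0$ satisfy, for all $(x,u),(y,z)\in\Sigma_N$, with $\overline R=S^\top RS$, $$\big|\|x\|_Q^2+\|u\|_{\overline R}^2-\|y\|_Q^2-\|z\|_{\overline R}^2\big|\le M_x\|x-y\|+M_u\|u-z\|,\qquad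 \big|\|x\|_P^2-\|y\|_P^2\big|\le M_x\|x-y\|.$$ **Theorem.** A decay rate exists. For every decay rate $\beta$, admissible constants exist, and the following hold. 1. For all admissible constants, all $(\ell_k)$ with $\ell_k>\ell^\star$ for every $k\in\mathbb N$, all $x_0$ with $(x_0,u_0)\in\Sigma_N$ and all $T\ge1$, $$\mathcal R_T(x_0)\le\overline M\big(\tilde\eta_{\ell,0}\|\delta u_0\|+L\Delta^\top\tilde\eta_\ell\big),\qquad \overline M=M_u+\frac{c_w\|\overline B\|(M_uL+M_x)}{1-\rho}.$$ 2. There is $C$ such that for all such $(\ell_k)$, $x_0$ and $T\ge 1$: $|\mathcal R_T(x_0)|\le C(\tilde\eta_{\ell,0}+\bar\eta_\ell)\|x_0\|$. 3. $\mathcal R_T(x_0)=\mathcal O(\bar\eta_\ell\|x_0\|)$: for every $p\in\mathbb N$ there is $C$ such that for all such $(\ell_k)$ with $\ell_1\le\ell_0+p$, all such $x_0$ and all $T\ge2$: $|\mathcal R_T(x_0)|\le C\,\bar\eta_\ell\|x_0\|$. (Every sequence is covered with $p=\ell_1$, so for a fixed sequence the constant does not depend on $x_0$ or $T$.) 4.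 There is $C$ such that for every constant $\ell_k=\ell>\ell^\star$, all $x_0$ with $(x_0,u_0)\in\Sigma_N$ and all $T\ge1$: $|\mathcal R_T(x_0)|\le C\,\dfrac{\eta^\ell}{1-\eta^\ell}\,\|x_0\|$. The constants $C$ depend only on $A,B,Q,R,P,\mathcal U,N,c,\beta$ (and on $p$ in 3). -/

import Mathlib

open scoped Matrix Matrix.Norms.L2Operator MatrixOrder

noncomputable section

namespace LQMPC

/-! ### Generalities -/

/-- Euclidean space of real vectors indexed by a finite type. -/
abbrev Vec (ι : Type) := EuclideanSpace ℝ ι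

/-- A point of `S` at which `φ` attains its minimum over `S`. -/
def argminOn {E : Type} [Nonempty E] (S : Set E) (φ : E → ℝ) : E :=
  Classical.epsilon fun y => y ∈ S ∧ ∀ z ∈ S, φ y ≤ φ z

/-- Euclidean projection onto a (nonempty closed convex) set. -/
def proj {ι : Type} [Fintype ι] (S : Set (Vec ι)) (x : Vec ι) : Vec ι :=
  argminOn S fun y => ‖x - y‖

/-- The matrix-vector product on Euclidean spaces. -/
def act {ι κ : Type} [Fintype ι] (A : Matrix κ ι ℝ) (x : Vec ι) : Vec κ :=
  WithLp.toLp 2 (A *ᵥ x.ofLp)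

/-- The squared weighted norm `xᵀ Q x`. -/
def quad {ι : Type} [Fintype ι] (Q : Matrix ι ι ℝ) (x : Vec ι) : ℝ :=
  x.ofLp ⬝ᵥ (Q *ᵥ x.ofLp)

/-- Smallest eigenvalue of a symmetric matrix. -/
def lamMin {ι : Type} [Fintype ι] [DecidableEq ι] (W : Matrix ι ι ℝ) : ℝ :=
  sInf (spectrum ℝ W)

/-- Largest eigenvalue of a symmetric matrix. -/
def lamMax {ι : Type} [Fintype ι] [DecidableEq ι] (W : Matrix ι ι ℝ) : ℝ :=
  sSup (spectrum ℝ W)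

/-- The inverse square root of a positive definite matrix. -/
def invSqrt {ι : Type} [Fintype ι] [DecidableEq ι] (M : Matrix ι ι ℝ) : Matrix ι ι ℝ :=
  (CFC.sqrt M)⁻¹

/-- Largest eigenvalue of `W` relative to `M`, i.e. of `M^{-1/2} W M^{-1/2}`. -/
def lamMaxRel {ι : Type} [Fintype ι] [DecidableEq ι] (M W : Matrix ι ι ℝ) : ℝ :=
  lamMax (invSqrt M * W * invSqrt M)

/-- The pair `(A, B)` is stabilizable: some state feedback `A - B F` has all its complex
eigenvalues in the open unit disc. -/
def Stabilizable {n m : ℕ} (A : Matrix (Fin n) (Fin n) ℝ) (B : Matrix (Fin n) (Fin m) ℝ) : Prop :=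
  ∃ F : Matrix (Fin m) (Fin n) ℝ,
    spectralRadius ℂ ((A - B * F).map (algebraMap ℝ ℂ)) < 1

/-- Exponential incremental input-to-state stability of `x⁺ = f x` in the forward invariant set
`D`, with gains `c₀`, `cw`, rate `ρ`, for disturbances of norm at most `rw`. -/
structure IsEDeltaISS {E : Type} [NormedAddCommGroup E] (f : E → E) (D : Set E)
    (c₀ cw rw ρ : ℝ) : Prop where
  invariant : Set.MapsTo f D D
  c₀_pos : 0 < c₀
  cw_pos : 0 < cw
  rw_pos : 0 < rw
  ρ_pos : 0 < ρ
  ρ_lt_one : ρ < 1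
  bound : ∀ x y w : ℕ → E,
    (∀ k, x (k + 1) = f (x k)) → (∀ k, y (k + 1) = f (y k) + w k) →
    x 0 ∈ D → (∀ k, y k ∈ D) → (∀ k, ‖w k‖ ≤ rw) →
    ∀ k, ‖x k - y k‖ ≤
      c₀ * ρ ^ k * ‖x 0 - y 0‖ + cw * ∑ i ∈ Finset.range k, ρ ^ (k - i - 1) * ‖w i‖

/-! ### The linear-quadratic problem -/

/-- The data of a linear-quadratic MPC problem with `n` states, `m` inputs and prediction
horizon `N`. -/
structure Data (n m N : ℕ) where
  A : Matrix (Fin n) (Fin n) ℝ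
  B : Matrix (Fin n) (Fin m) ℝ
  Q : Matrix (Fin n) (Fin n) ℝ
  R : Matrix (Fin m) (Fin m) ℝ
  P : Matrix (Fin n) (Fin n) ℝ
  U : Set (Vec (Fin m))

namespace Data

variable {n m N : ℕ} (D : Data n m N)

/-- The gain `K = (R + Bᵀ P B)⁻¹ Bᵀ P A`. -/
def K : Matrix (Fin m) (Fin n) ℝ :=
  (D.R + D.Bᵀ * D.P * D.B)⁻¹ * (D.Bᵀ * D.P * D.A)

/-- The standing assumptions: `(A, B)` stabilizable, `Q, R ≻ 0`, the input constraint set is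
closed, convex and contains the origin in its interior, and `P` is the positive semidefinite
solution of the discrete-time algebraic Riccati equation. -/
structure WellPosed : Prop where
  stabilizable : Stabilizable D.A D.B
  Q_pos : D.Q.PosDef
  R_pos : D.R.PosDef
  U_closed : IsClosed D.U
  U_convex : Convex ℝ D.U
  U_zero : (0 : Vec (Fin m)) ∈ interior D.U
  P_psd : D.P.PosSemidef
  P_riccati : D.P = D.Q + D.Kᵀ * D.R * D.K + (D.A - D.B * D.K)ᵀ * D.P * (D.A - D.B * D.K)

/-- State at time `k` of `x⁺ = A x + B u` started at `x`, under the input sequence `u`. -/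
def state (x : Vec (Fin n)) (u : ℕ → Vec (Fin m)) : ℕ → Vec (Fin n)
  | 0 => x
  | k + 1 => act D.A (state x u k) + act D.B (u k)

/-- The cost `J_T(x, u) = ‖x_T‖²_P + ∑_{k < T} (‖x_k‖²_Q + ‖u_k‖²_R)`. -/
def cost (T : ℕ) (x : Vec (Fin n)) (u : ℕ → Vec (Fin m)) : ℝ :=
  quad D.P (D.state x u T) +
    ∑ k ∈ Finset.range T, (quad D.Q (D.state x u k) + quad D.R (u k))

/-- The `i`-th input in a stacked vector of `N` inputs (zero for `i ≥ N`). -/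
def block (ν : Vec (Fin N × Fin m)) (i : ℕ) : Vec (Fin m) :=
  WithLp.toLp 2 fun b => if h : i < N then ν (⟨i, h⟩, b) else 0

/-- The open-loop cost `J_N(x, ν)` of a stacked input vector. -/
def openCost (x : Vec (Fin n)) (ν : Vec (Fin N × Fin m)) : ℝ :=
  D.cost N x (block ν)

/-- The set `U^N` of feasible stacked input vectors. -/
def inputs : Set (Vec (Fin N × Fin m)) :=
  {ν | ∀ i < N, block ν i ∈ D.U}

/-- The optimal mapping `μ⋆(x) = argmin_{ν ∈ U^N} J_N(x, ν)`. -/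
def muStar (x : Vec (Fin n)) : Vec (Fin N × Fin m) :=
  argminOn D.inputs (D.openCost x)

/-- `ψ(x) = √(J_N(x, μ⋆(x)))`. -/
def psi (x : Vec (Fin n)) : ℝ :=
  √(D.openCost x (D.muStar x))

/-! ### Condensed matrices: `J_N(x, ν) = xᵀ W x + 2 νᵀ G x + νᵀ H ν` -/

/-- The matrix of the map from `ν` to the predicted state `ξ_i` for `ξ_0 = 0`. -/
def predict (i : ℕ) : Matrix (Fin n) (Fin N × Fin m) ℝ :=
  Matrix.of fun a jb => if (jb.1 : ℕ) < i then (D.A ^ (i - 1 - jb.1) * D.B) a jb.2 else 0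

def W : Matrix (Fin n) (Fin n) ℝ :=
  (D.A ^ N)ᵀ * D.P * D.A ^ N + ∑ i ∈ Finset.range N, (D.A ^ i)ᵀ * D.Q * D.A ^ i

def G : Matrix (Fin N × Fin m) (Fin n) ℝ :=
  (D.predict N)ᵀ * D.P * D.A ^ N + ∑ i ∈ Finset.range N, (D.predict i)ᵀ * D.Q * D.A ^ i

def H : Matrix (Fin N × Fin m) (Fin N × Fin m) ℝ :=
  (D.predict N)ᵀ * D.P * D.predict N +
    ∑ i ∈ Finset.range N, (D.predict i)ᵀ * D.Q * D.predict i +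
    Matrix.of fun ja kb => if ja.1 = kb.1 then D.R ja.2 kb.2 else 0

/-- The matrix `S = [I 0 ⋯ 0]` selecting the first input. -/
def S (m N : ℕ) : Matrix (Fin m) (Fin N × Fin m) ℝ :=
  Matrix.of fun a jb => if (jb.1 : ℕ) = 0 ∧ a = jb.2 then 1 else 0

/-- `B̄ = B S`. -/
def Bbar : Matrix (Fin n) (Fin N × Fin m) ℝ := D.B * S m N

/-! ### Optimal and time-distributed MPC -/

/-- The closed loop under optimal MPC. -/
def f (x : Vec (Fin n)) : Vec (Fin n) :=
  act D.A x + act D.Bbar (D.muStar x)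

/-- The trajectory of optimal MPC. -/
def xStar (x₀ : Vec (Fin n)) (k : ℕ) : Vec (Fin n) := D.f^[k] x₀

/-- The step size `α = 1 / (λ⁺(H) + λ⁻(H))`. -/
def stepSize : ℝ := 1 / (lamMax D.H + lamMin D.H)

/-- One step of the projected gradient method. -/
def pgm (x : Vec (Fin n)) (ν : Vec (Fin N × Fin m)) : Vec (Fin N × Fin m) :=
  proj D.inputs (ν - D.stepSize • gradient (D.openCost x) ν)

/-- The combined system-optimizer dynamics: the pair `(x_k, u_k)`, where `u_k` is obtained from
`u_{k-1}` by `ℓ k` steps of the projected gradient method at the state `x_k`, and `u_{-1} = 0`. -/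
def combined (l : ℕ → ℕ) (x₀ : Vec (Fin n)) : ℕ → Vec (Fin n) × Vec (Fin N × Fin m)
  | 0 => (x₀, (D.pgm x₀)^[l 0] 0)
  | k + 1 =>
    let x := act D.A (combined l x₀ k).1 + act D.Bbar (combined l x₀ k).2
    (x, (D.pgm x)^[l (k + 1)] (combined l x₀ k).2)

/-- The state `x_k` of the suboptimal MPC scheme. -/
def xSub (l : ℕ → ℕ) (x₀ : Vec (Fin n)) (k : ℕ) : Vec (Fin n) := (D.combined l x₀ k).1

/-- The stacked input `u_k` of the suboptimal MPC scheme. -/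
def uSub (l : ℕ → ℕ) (x₀ : Vec (Fin n)) (k : ℕ) : Vec (Fin N × Fin m) := (D.combined l x₀ k).2

/-- The suboptimality gap: closed-loop cost over `T` steps of the suboptimal scheme minus that
of optimal MPC, each applying the first block of its stacked input. -/
def gap (l : ℕ → ℕ) (T : ℕ) (x₀ : Vec (Fin n)) : ℝ :=
  D.cost T x₀ (fun k => act (S m N) (D.uSub l x₀ k)) -
    D.cost T x₀ (fun k => act (S m N) (D.muStar (D.xStar x₀ k)))

/-! ### Regions of attraction and constants -/

/-- `r_N = √(N d + c)` with `d = c λ⁻(Q) / λ⁺(P)`. -/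
def rN (c : ℝ) : ℝ := √(N * (c * (lamMin D.Q / lamMax D.P)) + c)

/-- `Γ_N = {x | ψ(x) ≤ r_N}`. -/
def Gam (c : ℝ) : Set (Vec (Fin n)) := {x | D.psi x ≤ D.rN c}

/-- `c > 0` is such that `Ω = {‖x‖²_P ≤ c}` is contained in `{-K x ∈ U}`. -/
def IsLevel (c : ℝ) : Prop :=
  0 < c ∧ {x : Vec (Fin n) | quad D.P x ≤ c} ⊆ {x | -act D.K x ∈ D.U}

/-- `β ∈ (0,1)` is an exponential decay rate of `ψ` along optimal MPC in `Γ_N`. -/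
def IsDecayRate (c β : ℝ) : Prop :=
  0 < β ∧ β < 1 ∧ ∀ x ∈ D.Gam c, D.psi (D.f x) ≤ β * D.psi x

/-- The contraction rate `η` of the projected gradient method. -/
def eta : ℝ := (lamMax D.H - lamMin D.H) / (lamMax D.H + lamMin D.H)

/-- The Lipschitz constant `L = ‖H^{-1/2}‖ ‖H^{-1/2} G‖` of the optimal mapping. -/
def L : ℝ := ‖invSqrt D.H‖ * ‖invSqrt D.H * D.G‖

def sigma : ℝ := ‖CFC.sqrt D.W * D.Bbar‖

def omega : ℝ := 1 + ‖invSqrt D.H‖ * ‖invSqrt D.H * D.G * D.Bbar‖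

def kappa : ℝ :=
  ‖invSqrt D.H‖ * ‖invSqrt D.H * D.G * (D.A - 1) * invSqrt D.P‖ +
    ‖invSqrt D.H‖ *
      √(lamMaxRel D.H ((D.G * D.Bbar)ᵀ * D.H⁻¹ * (D.G * D.Bbar)) * (lamMaxRel D.P D.W - 1))

/-- The threshold `ℓ⋆`. If `η = 0`, both the convention `log 0 = -∞` and the formula below
give `ℓ⋆ = 0`. -/
def lStar (β : ℝ) : ℝ :=
  (Real.log (1 - β) - Real.log (D.sigma * D.kappa + D.omega * (1 - β))) / Real.log D.eta

/-- The set `Σ_N`. If `σ = 0`, that is `B = 0`, the formula below reads `z = μ⋆(x)`; in that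
case every iterate of the scheme equals `μ⋆`, which is identically `0`. -/
def Sig (c β : ℝ) : Set (Vec (Fin n) × Vec (Fin N × Fin m)) :=
  {p | p.1 ∈ D.Gam c ∧ p.2 ∈ D.inputs ∧
    ‖p.2 - D.muStar p.1‖ ≤ (1 - β) * D.rN c / D.sigma}

/-- The stage cost `‖x‖²_Q + ‖u‖²_R̄` with `R̄ = Sᵀ R S`, as a function of the stacked input. -/
def stageCost (x : Vec (Fin n)) (u : Vec (Fin N × Fin m)) : ℝ :=
  quad D.Q x + quad ((S m N)ᵀ * D.R * S m N) u

/-- `Mx, Mu` are Lipschitz constants of the stage cost and of the terminal cost on a set of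
state-input pairs. -/
def IsCostLipschitz (V : Set (Vec (Fin n) × Vec (Fin N × Fin m))) (Mx Mu : ℝ) : Prop :=
  0 < Mx ∧ 0 < Mu ∧ ∀ p ∈ V, ∀ q ∈ V,
    |D.stageCost p.1 p.2 - D.stageCost q.1 q.2| ≤ Mx * ‖p.1 - q.1‖ + Mu * ‖p.2 - q.2‖ ∧
    |quad D.P p.1 - quad D.P q.1| ≤ Mx * ‖p.1 - q.1‖

/-- The constant `M̄ = M_u + c_w L_u (M_u L + M_x) / (1 - ρ)` with `L_u = ‖B̄‖`. -/
def Mbar (cw ρ Mx Mu : ℝ) : ℝ := Mu + cw * ‖D.Bbar‖ * (Mu * D.L + Mx) / (1 - ρ)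

/-! ### Suboptimality vector -/

/-- `etaAux l r k = η̃_{ℓ,k}` for the horizon `T = k + r`. -/
def etaAux (l : ℕ → ℕ) : ℕ → ℕ → ℝ
  | 0, _ => 0
  | r + 1, k => D.eta ^ l k * (1 + etaAux l r (k + 1))

/-- `η̃_{ℓ,k}` for the horizon `T`: `η̃_{ℓ,k} = η^{ℓ_k} (1 + η̃_{ℓ,k+1})` for `k + 1 < T` and
`η̃_{ℓ,T-1} = η^{ℓ_{T-1}}`. -/
def etaTilde (l : ℕ → ℕ) (T k : ℕ) : ℝ := D.etaAux l (T - k) k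

/-- `η̄_ℓ`, the Euclidean norm of `(η̃_{ℓ,1}, …, η̃_{ℓ,T-1})`. -/
def etaBar (l : ℕ → ℕ) (T : ℕ) : ℝ := √(∑ k ∈ Finset.Ico 1 T, D.etaTilde l T k ^ 2)

/-- `Δᵀ η̃_ℓ = ∑_{k=1}^{T-1} ‖x_k - x_{k-1}‖ η̃_{ℓ,k}`. -/
def pathTerm (l : ℕ → ℕ) (T : ℕ) (x₀ : Vec (Fin n)) : ℝ :=
  ∑ k ∈ Finset.Ico 1 T, ‖D.xSub l x₀ k - D.xSub l x₀ (k - 1)‖ * D.etaTilde l T k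

/-! ### The condensed form and the recursion for `η̃` agree with the definitions -/

lemma predict_succ (i : ℕ) (ν : Vec (Fin N × Fin m)) :
    act (D.predict (i + 1)) ν = act D.A (act (D.predict i) ν) + act D.B (block ν i) := by
  have key : D.predict (i + 1) = D.A * D.predict i +
      Matrix.of fun a jb => if (jb.1 : ℕ) = i then D.B a jb.2 else 0 := by
    ext a ⟨j, b⟩
    simp only [predict, Matrix.of_apply, Matrix.add_apply, Matrix.mul_apply]
    rcases lt_trichotomy (j : ℕ) i with h | h | h
    · have e : i + 1 - 1 - (j : ℕ) = (i - 1 - j) + 1 := by omega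
      rw [if_pos (by omega), e, pow_succ']
      simp [h, h.ne, Matrix.mul_assoc, ← Matrix.mul_apply]
    · subst h; simp [← Matrix.mul_apply]
    · simp [h.ne', not_lt.2 h.le, show ¬ ((j : ℕ) < i + 1) by omega]
  ext a
  simp only [act, key, Matrix.add_mulVec, Matrix.mulVec_mulVec, PiLp.add_apply, Pi.add_apply]
  congr 1
  simp only [Matrix.mulVec, dotProduct, Matrix.of_apply, block, Fintype.sum_prod_type]
  rw [Finset.sum_comm]
  refine Finset.sum_congr rfl fun b _ => ?_
  by_cases h : i < N
  · rw [Finset.sum_eq_single ⟨i, h⟩]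
    · simp [h]
    · intro j _ hj
      simp [show (j : ℕ) ≠ i from fun e => hj (Fin.ext e)]
    · simp
  · rw [Finset.sum_eq_zero]
    · simp [h]
    · intro j _
      simp [show (j : ℕ) ≠ i from fun e => h (e ▸ j.2)]

lemma state_block (x : Vec (Fin n)) (ν : Vec (Fin N × Fin m)) (i : ℕ) :
    D.state x (block ν) i = act (D.A ^ i) x + act (D.predict i) ν := by
  induction i with
  | zero =>
    ext a
    simp [state, act, predict, Matrix.mulVec, dotProduct]
  | succ i ih =>
    rw [state, ih, predict_succ, ← add_assoc]
    congr 1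
    ext a
    simp [act, Matrix.mulVec_add, Matrix.mulVec_mulVec, pow_succ']

lemma quad_pred {M : Matrix (Fin n) (Fin n) ℝ} (hM : M.IsHermitian)
    (x : Vec (Fin n)) (ν : Vec (Fin N × Fin m)) (i : ℕ) :
    quad M (act (D.A ^ i) x + act (D.predict i) ν) =
      quad ((D.A ^ i)ᵀ * M * D.A ^ i) x +
        2 * (ν.ofLp ⬝ᵥ (((D.predict i)ᵀ * M * D.A ^ i) *ᵥ x.ofLp)) +
        quad ((D.predict i)ᵀ * M * D.predict i) ν := by
  have hT : Mᵀ = M := by rw [← Matrix.conjTranspose_eq_transpose_of_trivial]; exact hM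
  have e : ∀ {ι κ : Type} [Fintype ι] [Fintype κ] (X : Matrix (Fin n) ι ℝ)
      (Y : Matrix (Fin n) κ ℝ) (v : ι → ℝ) (w : κ → ℝ),
      v ⬝ᵥ ((Xᵀ * M * Y) *ᵥ w) = (X *ᵥ v) ⬝ᵥ (M *ᵥ (Y *ᵥ w)) := by
    intro ι κ _ _ X Y v w
    rw [Matrix.mul_assoc, ← Matrix.mulVec_mulVec, ← Matrix.mulVec_mulVec,
      Matrix.dotProduct_mulVec v, Matrix.vecMul_transpose]
  have sy : ∀ v w : Fin n → ℝ, v ⬝ᵥ (M *ᵥ w) = w ⬝ᵥ (M *ᵥ v) := by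
    intro v w
    rw [Matrix.dotProduct_mulVec, ← Matrix.mulVec_transpose, hT, dotProduct_comm]
  simp only [quad, e, act, WithLp.ofLp_add, Matrix.mulVec_add, dotProduct_add, add_dotProduct]
  rw [sy (D.A ^ i *ᵥ x.ofLp) (D.predict i *ᵥ ν.ofLp)]
  ring

/-- The open-loop cost in condensed form. -/
theorem openCost_eq (hQ : D.Q.IsHermitian) (hP : D.P.IsHermitian)
    (x : Vec (Fin n)) (ν : Vec (Fin N × Fin m)) :
    D.openCost x ν =
      quad D.W x + 2 * (ν.ofLp ⬝ᵥ (D.G *ᵥ x.ofLp)) + quad D.H ν := by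
  have hR : ∑ i ∈ Finset.range N, quad D.R (block ν i) =
      quad (Matrix.of fun ja kb : Fin N × Fin m =>
        if ja.1 = kb.1 then D.R ja.2 kb.2 else 0) ν := by
    rw [Finset.sum_range]
    simp [quad, block, Matrix.mulVec, dotProduct, Fintype.sum_prod_type, ite_mul,
      Finset.sum_ite_irrel]
  simp only [openCost, cost, state_block, quad_pred D hQ, quad_pred D hP, Finset.sum_add_distrib,
    hR]
  simp only [quad, W, G, H, Matrix.add_mulVec, dotProduct_add, Matrix.sum_mulVec,
    dotProduct_sum, Finset.mul_sum, mul_add]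
  ring

lemma etaTilde_last (l : ℕ → ℕ) (T : ℕ) : D.etaTilde l (T + 1) T = D.eta ^ l T := by
  simp [etaTilde, etaAux]

lemma etaTilde_rec (l : ℕ → ℕ) {T k : ℕ} (h : k + 1 < T) :
    D.etaTilde l T k = D.eta ^ l k * (1 + D.etaTilde l T (k + 1)) := by
  obtain ⟨r, rfl⟩ : ∃ r, T = k + 1 + r := ⟨T - (k + 1), by omega⟩
  have h1 : k + 1 + r - k = r + 1 := by omega
  have h2 : k + 1 + r - (k + 1) = r := by omega
  simp [etaTilde, etaAux, h1, h2]

end Data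

end LQMPC

end

open scoped RealInnerProductSpace

noncomputable section

namespace LQMPC

/-! ### Matrices acting on Euclidean spaces -/

section LinearAlgebra

variable {ι κ τ : Type} [Fintype ι] [Fintype τ]

/-! Time-distributed MPC is optimal MPC driven by the disturbance `B̄(u_k - μ⋆(x_k))`. If the
optimal loop is incrementally stable, the distance between the two closed-loop trajectories is a
geometric convolution of the errors `d_k = ‖u_k - μ⋆(x_k)‖`. The costs are Lipschitz on the bounded
set `Σ_N`, so the gap is at most `M̄ ∑ d_k` (`abs_gap_le_sum`). A projected gradient step contracts
towards `μ⋆` at rate `η`, and `μ⋆` is `L`-Lipschitz, whence `d_{k+1} ≤ η^{ℓ_{k+1}} (d_k + L ‖x_{k+1}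
- x_k‖)`. Summing this recursion backwards in time produces the weights `η̃` and the explicit bound
(`sum_subopt_le`).

Incremental stability: completing the square with the Riccati equation (`quad_step`) writes `J_T` as
`‖x‖²_P` plus squared deviations from the feedback `-Kx`. Hence `‖x‖_P ≤ ψ(x)`, optimal MPC is the
linear feedback on `Ω = {‖x‖²_P ≤ c}`, and optimal predictions from `Γ_N` end in `Ω`
(`terminal_le`). The shifted candidate then gives exponential decay of `ψ`. Under small disturbances
every trajectory in `Γ_N` is in `Ω` after a fixed number of steps, where `f` contracts the `P`-norm;
large disturbances are paid for by the boundedness of `Γ_N` (`exists_isEDeltaISS`).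

Invariance and path length: `ψ(x_k)` and `d_k` satisfy a coupled linear recursion with coefficients
`β, σ` and `η^ℓ ω, η^ℓ κ`, for which `ℓ > ℓ⋆` is a small-gain condition. It makes `Σ_N` forward
invariant (`mem_Sig`) and bounds `∑ ψ(x_k)`, hence the path length, by a multiple of `‖x₀‖`
uniformly in the horizon and the iteration numbers (`exists_sum_norm_xSub_sub_le`). So `Δᵀη̃` is at
most `max η̃` times `C‖x₀‖`, and the orders of the gap follow from bounds on the weights
(`exists_abs_gap_le`). -/

lemma act_add (A : Matrix κ ι ℝ) (x y : Vec ι) : act A (x + y) = act A x + act A y := by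
  ext a; simp [act, Matrix.mulVec_add]

lemma act_sub (A : Matrix κ ι ℝ) (x y : Vec ι) : act A (x - y) = act A x - act A y := by
  ext a; simp [act, Matrix.mulVec_sub]

lemma act_neg (A : Matrix κ ι ℝ) (x : Vec ι) : act A (-x) = -act A x := by
  ext a; simp [act, Matrix.mulVec_neg]

lemma act_smul (A : Matrix κ ι ℝ) (t : ℝ) (x : Vec ι) : act A (t • x) = t • act A x := by
  ext a; simp [act, Matrix.mulVec_smul]

@[simp] lemma act_zero (A : Matrix κ ι ℝ) : act A (0 : Vec ι) = 0 := by
  ext a; simp [act]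

@[simp] lemma zero_act (x : Vec ι) : act (0 : Matrix κ ι ℝ) x = 0 := by
  ext a; simp [act]

@[simp] lemma one_act [DecidableEq ι] (x : Vec ι) : act (1 : Matrix ι ι ℝ) x = x := by
  ext a; simp [act]

lemma mul_act (A : Matrix κ ι ℝ) (B : Matrix ι τ ℝ) (x : Vec τ) :
    act (A * B) x = act A (act B x) := by
  ext a; simp [act, Matrix.mulVec_mulVec]

lemma add_act (A B : Matrix κ ι ℝ) (x : Vec ι) : act (A + B) x = act A x + act B x := by
  ext a; simp [act, Matrix.add_mulVec]

lemma sub_act (A B : Matrix κ ι ℝ) (x : Vec ι) : act (A - B) x = act A x - act B x := by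
  ext a; simp [act, Matrix.sub_mulVec]

variable [Fintype κ]

lemma norm_act_le [DecidableEq ι] (A : Matrix κ ι ℝ) (x : Vec ι) : ‖act A x‖ ≤ ‖A‖ * ‖x‖ :=
  Matrix.l2_opNorm_mulVec A x

lemma inner_eq_dotProduct (x y : Vec ι) : ⟪x, y⟫ = x.ofLp ⬝ᵥ y.ofLp := by
  rw [EuclideanSpace.inner_eq_star_dotProduct, star_trivial, dotProduct_comm]

lemma quad_eq_inner (M : Matrix ι ι ℝ) (x : Vec ι) : quad M x = ⟪x, act M x⟫ := by
  rw [inner_eq_dotProduct]; rfl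

lemma inner_act (A : Matrix κ ι ℝ) (x : Vec κ) (y : Vec ι) : ⟪x, act A y⟫ = ⟪act Aᵀ x, y⟫ := by
  simp only [inner_eq_dotProduct, act]
  rw [Matrix.dotProduct_mulVec, Matrix.mulVec_transpose]

lemma inner_act_symm {M : Matrix ι ι ℝ} (hM : M.IsHermitian) (x y : Vec ι) :
    ⟪x, act M y⟫ = ⟪act M x, y⟫ := by
  have hT : Mᵀ = M := by rw [← Matrix.conjTranspose_eq_transpose_of_trivial]; exact hM
  rw [inner_act, hT]

lemma quad_congr (M : Matrix κ κ ℝ) (X : Matrix κ ι ℝ) (x : Vec ι) :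
    quad (Xᵀ * M * X) x = quad M (act X x) := by
  rw [quad_eq_inner, quad_eq_inner, mul_act, mul_act, inner_act, Matrix.transpose_transpose]

lemma quad_matrix_add (M M' : Matrix ι ι ℝ) (x : Vec ι) :
    quad (M + M') x = quad M x + quad M' x := by
  simp only [quad_eq_inner, add_act, inner_add_right]

@[simp] lemma quad_zero (M : Matrix ι ι ℝ) : quad M (0 : Vec ι) = 0 := by
  simp [quad_eq_inner]

lemma quad_neg (M : Matrix ι ι ℝ) (x : Vec ι) : quad M (-x) = quad M x := by
  simp [quad_eq_inner, act_neg]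

lemma quad_add {M : Matrix ι ι ℝ} (hM : M.IsHermitian) (x y : Vec ι) :
    quad M (x + y) = quad M x + 2 * ⟪act M x, y⟫ + quad M y := by
  simp only [quad_eq_inner, act_add, inner_add_left, inner_add_right]
  rw [inner_act_symm hM x y, real_inner_comm y (act M x)]
  ring

lemma quad_smul (M : Matrix ι ι ℝ) (t : ℝ) (x : Vec ι) : quad M (t • x) = t ^ 2 * quad M x := by
  simp only [quad_eq_inner, act_smul, inner_smul_left, inner_smul_right]
  simp; ring

lemma quad_nonneg {M : Matrix ι ι ℝ} (hM : M.PosSemidef) (x : Vec ι) : 0 ≤ quad M x := by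
  simpa [quad] using hM.dotProduct_mulVec_nonneg x.ofLp

lemma quad_pos {M : Matrix ι ι ℝ} (hM : M.PosDef) {x : Vec ι} (hx : x ≠ 0) : 0 < quad M x := by
  have : x.ofLp ≠ 0 := fun h => hx (by ext i; simp [h])
  simpa [quad] using hM.dotProduct_mulVec_pos this

lemma posDef_of_quad_pos {M : Matrix ι ι ℝ} (hM : M.IsHermitian)
    (h : ∀ x : Vec ι, x ≠ 0 → 0 < quad M x) : M.PosDef := by
  refine Matrix.PosDef.of_dotProduct_mulVec_pos hM fun x hx => ?_
  have := h (WithLp.toLp 2 x) (fun h0 => hx (by simpa using congrArg WithLp.ofLp h0))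
  simpa [quad] using this

lemma abs_quad_sub_le [DecidableEq ι] (M : Matrix ι ι ℝ) (x y : Vec ι) :
    |quad M x - quad M y| ≤ ‖M‖ * (‖x‖ + ‖y‖) * ‖x - y‖ := by
  have h : quad M x - quad M y = ⟪x, act M (x - y)⟫ + ⟪x - y, act M y⟫ := by
    simp only [quad_eq_inner, act_sub, inner_sub_left, inner_sub_right]; ring
  rw [h]
  have h1 := abs_real_inner_le_norm x (act M (x - y))
  have h2 := abs_real_inner_le_norm (x - y) (act M y)
  have h3 := mul_le_mul_of_nonneg_left (norm_act_le M (x - y)) (norm_nonneg x)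
  have h4 := mul_le_mul_of_nonneg_left (norm_act_le M y) (norm_nonneg (x - y))
  calc _ ≤ _ := abs_add_le _ _
    _ ≤ ‖x‖ * (‖M‖ * ‖x - y‖) + ‖x - y‖ * (‖M‖ * ‖y‖) := by linarith
    _ = _ := by ring

/-! ### Spectral bounds for symmetric matrices. -/

variable [DecidableEq ι]

/-- Parseval in an eigenbasis. Having the three quantities as sums with the same weights reduces
quadratic form inequalities to scalar ones for the eigenvalues. -/
lemma quad_eq_sum_eigenvalues {M : Matrix ι ι ℝ} (hM : M.IsHermitian) (x : Vec ι) :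
    quad M x = ∑ i, hM.eigenvalues i * ⟪hM.eigenvectorBasis i, x⟫ ^ 2 ∧
    ‖act M x‖ ^ 2 = ∑ i, hM.eigenvalues i ^ 2 * ⟪hM.eigenvectorBasis i, x⟫ ^ 2 ∧
    ‖x‖ ^ 2 = ∑ i, ⟪hM.eigenvectorBasis i, x⟫ ^ 2 := by
  set b := hM.eigenvectorBasis
  have hb : ∀ i, ⟪b i, act M x⟫ = hM.eigenvalues i * ⟪b i, x⟫ := by
    intro i
    have : act M (b i) = hM.eigenvalues i • b i := by
      ext a
      simpa [act, b] using congrFun (hM.mulVec_eigenvectorBasis i) a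
    rw [inner_act_symm hM, this, inner_smul_left]; simp
  refine ⟨?_, ?_, ?_⟩
  · rw [quad_eq_inner, ← b.sum_inner_mul_inner]
    refine Finset.sum_congr rfl fun i _ => ?_
    rw [hb, real_inner_comm]; ring
  · rw [← b.sum_sq_norm_inner_right]
    refine Finset.sum_congr rfl fun i _ => ?_
    rw [hb, Real.norm_eq_abs, sq_abs]; ring
  · rw [← b.sum_sq_norm_inner_right]
    refine Finset.sum_congr rfl fun i _ => ?_
    rw [Real.norm_eq_abs, sq_abs]

lemma lamMin_le_eigenvalues {M : Matrix ι ι ℝ} (hM : M.IsHermitian) (i : ι) :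
    lamMin M ≤ hM.eigenvalues i :=
  csInf_le (M.finite_real_spectrum).bddBelow (hM.eigenvalues_mem_spectrum_real i)

lemma eigenvalues_le_lamMax {M : Matrix ι ι ℝ} (hM : M.IsHermitian) (i : ι) :
    hM.eigenvalues i ≤ lamMax M :=
  le_csSup (M.finite_real_spectrum).bddAbove (hM.eigenvalues_mem_spectrum_real i)

lemma lamMin_mul_le_quad {M : Matrix ι ι ℝ} (hM : M.IsHermitian) (x : Vec ι) :
    lamMin M * ‖x‖ ^ 2 ≤ quad M x := by
  obtain ⟨h1, -, h3⟩ := quad_eq_sum_eigenvalues hM x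
  rw [h1, h3, Finset.mul_sum]
  exact Finset.sum_le_sum fun i _ =>
    mul_le_mul_of_nonneg_right (lamMin_le_eigenvalues hM i) (sq_nonneg _)

lemma quad_le_lamMax_mul {M : Matrix ι ι ℝ} (hM : M.IsHermitian) (x : Vec ι) :
    quad M x ≤ lamMax M * ‖x‖ ^ 2 := by
  obtain ⟨h1, -, h3⟩ := quad_eq_sum_eigenvalues hM x
  rw [h1, h3, Finset.mul_sum]
  exact Finset.sum_le_sum fun i _ =>
    mul_le_mul_of_nonneg_right (eigenvalues_le_lamMax hM i) (sq_nonneg _)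

/-- This is `(M - λ⁻)(λ⁺ - M) ⪰ 0`, checked on each eigenvalue. It yields the contraction rate of
the gradient step. -/
lemma norm_act_sq_le {M : Matrix ι ι ℝ} (hM : M.IsHermitian) (x : Vec ι) :
    ‖act M x‖ ^ 2 - (lamMax M + lamMin M) * quad M x + lamMax M * lamMin M * ‖x‖ ^ 2 ≤ 0 := by
  obtain ⟨h1, h2, h3⟩ := quad_eq_sum_eigenvalues hM x
  rw [h1, h2, h3, Finset.mul_sum, Finset.mul_sum, ← Finset.sum_sub_distrib,
    ← Finset.sum_add_distrib]
  refine Finset.sum_nonpos fun i _ => ?_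
  have := mul_nonneg (mul_nonneg (sub_nonneg.2 (lamMin_le_eigenvalues hM i))
    (sub_nonneg.2 (eigenvalues_le_lamMax hM i))) (sq_nonneg ⟪hM.eigenvectorBasis i, x⟫)
  linarith

lemma lamMax_nonneg {M : Matrix ι ι ℝ} (hM : M.PosSemidef) : 0 ≤ lamMax M :=
  Real.sSup_nonneg fun _ ha =>
    (Matrix.posSemidef_iff_isHermitian_and_spectrum_nonneg.1 hM).2 ha

lemma lamMin_nonneg {M : Matrix ι ι ℝ} (hM : M.PosSemidef) : 0 ≤ lamMin M :=
  Real.sInf_nonneg fun _ ha =>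
    (Matrix.posSemidef_iff_isHermitian_and_spectrum_nonneg.1 hM).2 ha

/-- Stated without `lamMin` so that it also covers the empty index type, where the spectrum is empty
and `lamMin` is `0`. -/
lemma exists_mul_le_quad {M : Matrix ι ι ℝ} (hM : M.PosDef) :
    ∃ q > 0, ∀ x : Vec ι, q * ‖x‖ ^ 2 ≤ quad M x := by
  rcases isEmpty_or_nonempty ι with h | h
  · refine ⟨1, one_pos, fun x => ?_⟩
    simp [Subsingleton.elim x 0]
  · obtain ⟨i, hi⟩ := Finite.exists_min hM.isHermitian.eigenvalues
    refine ⟨_, hM.eigenvalues_pos i, fun x => ?_⟩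
    obtain ⟨h1, -, h3⟩ := quad_eq_sum_eigenvalues hM.isHermitian x
    rw [h1, h3, Finset.mul_sum]
    exact Finset.sum_le_sum fun j _ => mul_le_mul_of_nonneg_right (hi j) (sq_nonneg _)

lemma lamMin_pos [Nonempty ι] {M : Matrix ι ι ℝ} (hM : M.PosDef) : 0 < lamMin M := by
  have hne : (spectrum ℝ M).Nonempty :=
    ⟨_, hM.isHermitian.eigenvalues_mem_spectrum_real (Classical.arbitrary ι)⟩
  have := hne.csInf_mem M.finite_real_spectrum
  rw [hM.isHermitian.spectrum_real_eq_range_eigenvalues] at this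
  obtain ⟨i, hi⟩ := this
  rw [lamMin, hM.isHermitian.spectrum_real_eq_range_eigenvalues, ← hi]
  exact hM.eigenvalues_pos i

lemma lamMin_le_lamMax {M : Matrix ι ι ℝ} (hM : M.PosSemidef) : lamMin M ≤ lamMax M := by
  rcases isEmpty_or_nonempty ι with h | h
  · simp [lamMin, lamMax]
  · exact (lamMin_le_eigenvalues hM.isHermitian (Classical.arbitrary ι)).trans
      (eigenvalues_le_lamMax hM.isHermitian _)

/-! ### Square roots of positive matrices -/

lemma sqrt_isHermitian (M : Matrix ι ι ℝ) : (CFC.sqrt M).IsHermitian :=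
  (Matrix.nonneg_iff_posSemidef.1 (CFC.sqrt_nonneg M)).isHermitian

lemma norm_sqrt_act_sq {M : Matrix ι ι ℝ} (hM : M.PosSemidef) (x : Vec ι) :
    ‖act (CFC.sqrt M) x‖ ^ 2 = quad M x := by
  have h : CFC.sqrt M * CFC.sqrt M = M :=
    CFC.sqrt_mul_sqrt_self M (Matrix.nonneg_iff_posSemidef.2 hM)
  rw [← real_inner_self_eq_norm_sq, ← inner_act_symm (sqrt_isHermitian M), ← mul_act, h,
    quad_eq_inner]

lemma norm_sqrt_act {M : Matrix ι ι ℝ} (hM : M.PosSemidef) (x : Vec ι) :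
    ‖act (CFC.sqrt M) x‖ = √(quad M x) := by
  rw [← norm_sqrt_act_sq hM, Real.sqrt_sq (norm_nonneg _)]

lemma isUnit_sqrt_det {M : Matrix ι ι ℝ} (hM : M.PosDef) : IsUnit (CFC.sqrt M).det := by
  have h : CFC.sqrt M * CFC.sqrt M = M :=
    CFC.sqrt_mul_sqrt_self M (Matrix.nonneg_iff_posSemidef.2 hM.posSemidef)
  have h2 := congrArg Matrix.det h
  rw [Matrix.det_mul] at h2
  refine isUnit_iff_ne_zero.2 fun h0 => hM.det_pos.ne' ?_
  rw [← h2, h0, zero_mul]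

lemma invSqrt_mul_sqrt {M : Matrix ι ι ℝ} (hM : M.PosDef) : invSqrt M * CFC.sqrt M = 1 :=
  Matrix.nonsing_inv_mul _ (isUnit_sqrt_det hM)

lemma invSqrt_isHermitian (M : Matrix ι ι ℝ) : (invSqrt M).IsHermitian :=
  (sqrt_isHermitian M).inv

lemma invSqrt_transpose (M : Matrix ι ι ℝ) : (invSqrt M)ᵀ = invSqrt M := by
  rw [← Matrix.conjTranspose_eq_transpose_of_trivial]; exact invSqrt_isHermitian M

lemma invSqrt_mul_invSqrt {M : Matrix ι ι ℝ} (hM : M.PosDef) : invSqrt M * invSqrt M = M⁻¹ := by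
  rw [invSqrt, ← Matrix.mul_inv_rev,
    CFC.sqrt_mul_sqrt_self M (Matrix.nonneg_iff_posSemidef.2 hM.posSemidef)]

lemma invSqrt_act_sqrt_act {M : Matrix ι ι ℝ} (hM : M.PosDef) (x : Vec ι) :
    act (invSqrt M) (act (CFC.sqrt M) x) = x := by
  rw [← mul_act, invSqrt_mul_sqrt hM, one_act]

lemma norm_le_invSqrt {M : Matrix ι ι ℝ} (hM : M.PosDef) (x : Vec ι) :
    ‖x‖ ≤ ‖invSqrt M‖ * ‖act (CFC.sqrt M) x‖ := by
  conv_lhs => rw [← invSqrt_act_sqrt_act hM x]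
  exact norm_act_le _ _

/-- Substituting `y = M^{1/2} x` turns this into the ordinary Rayleigh bound for `M^{-1/2} V
M^{-1/2}`. -/
lemma quad_le_lamMaxRel {M V : Matrix ι ι ℝ} (hM : M.PosDef) (hV : V.IsHermitian) (x : Vec ι) :
    quad V x ≤ lamMaxRel M V * quad M x := by
  have hH : (invSqrt M * V * invSqrt M).IsHermitian := by
    have := Matrix.isHermitian_conjTranspose_mul_mul (invSqrt M) hV
    rwa [(invSqrt_isHermitian M).eq] at this
  have h := quad_le_lamMax_mul hH (act (CFC.sqrt M) x)
  rw [norm_sqrt_act_sq hM.posSemidef] at h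
  have h2 : quad (invSqrt M * V * invSqrt M) (act (CFC.sqrt M) x) = quad V x := by
    nth_rw 1 [← invSqrt_transpose M]
    rw [quad_congr, invSqrt_act_sqrt_act hM]
  rwa [h2] at h

lemma lamMaxRel_nonneg {M V : Matrix ι ι ℝ} (hV : V.PosSemidef) : 0 ≤ lamMaxRel M V := by
  refine lamMax_nonneg ?_
  have := hV.conjTranspose_mul_mul_same (invSqrt M)
  rwa [(invSqrt_isHermitian M).eq] at this

end LinearAlgebra

/-! ### Projections -/

section Projection

variable {ι : Type} [Fintype ι]

lemma argminOn_spec {E : Type} [Nonempty E] {S : Set E} {φ : E → ℝ}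
    (h : ∃ y ∈ S, ∀ z ∈ S, φ y ≤ φ z) :
    argminOn S φ ∈ S ∧ ∀ z ∈ S, φ (argminOn S φ) ≤ φ z :=
  Classical.epsilon_spec (p := fun y => y ∈ S ∧ ∀ z ∈ S, φ y ≤ φ z) h

variable {S : Set (Vec ι)}

lemma proj_spec (hc : IsClosed S) (hn : S.Nonempty) (x : Vec ι) :
    proj S x ∈ S ∧ ∀ z ∈ S, ‖x - proj S x‖ ≤ ‖x - z‖ := by
  obtain ⟨y, hy, h⟩ := hc.exists_infDist_eq_dist hn x
  refine argminOn_spec (φ := fun y => ‖x - y‖) ⟨y, hy, fun z hz => ?_⟩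
  simpa only [← dist_eq_norm, ← h] using Metric.infDist_le_dist_of_mem hz

lemma proj_inner_le (hc : IsClosed S) (hv : Convex ℝ S) (hn : S.Nonempty)
    (x : Vec ι) {z : Vec ι} (hz : z ∈ S) :
    ⟪x - proj S x, z - proj S x⟫ ≤ 0 := by
  obtain ⟨h1, h2⟩ := proj_spec hc hn x
  refine (norm_eq_iInf_iff_real_inner_le_zero hv h1).1 ?_ z hz
  have : Nonempty S := hn.to_subtype
  exact le_antisymm (le_ciInf fun z => h2 z z.2)
    (ciInf_le ⟨0, by rintro _ ⟨w, rfl⟩; exact norm_nonneg _⟩ (⟨proj S x, h1⟩ : S))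

/-- Adding the obtuse-angle conditions at the two projections gives firm nonexpansiveness, and
Cauchy-Schwarz finishes. -/
lemma norm_proj_sub_proj_le (hc : IsClosed S) (hv : Convex ℝ S) (hn : S.Nonempty)
    (x y : Vec ι) : ‖proj S x - proj S y‖ ≤ ‖x - y‖ := by
  have h1 := proj_inner_le hc hv hn x (proj_spec hc hn y).1
  have h2 := proj_inner_le hc hv hn y (proj_spec hc hn x).1
  have h3 : ‖proj S x - proj S y‖ ^ 2 ≤ ⟪x - y, proj S x - proj S y⟫ := by
    rw [← real_inner_self_eq_norm_sq]
    simp only [inner_sub_left, inner_sub_right] at *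
    linarith
  have h4 := h3.trans (real_inner_le_norm _ _)
  rcases (norm_nonneg (proj S x - proj S y)).eq_or_lt with h | h
  · rw [← h]; exact norm_nonneg _
  · nlinarith

lemma proj_eq_of_inner_le (hc : IsClosed S) (hv : Convex ℝ S) (hn : S.Nonempty)
    {x y : Vec ι} (hy : y ∈ S) (h : ∀ z ∈ S, ⟪x - y, z - y⟫ ≤ 0) :
    proj S x = y := by
  have h1 := proj_inner_le hc hv hn x hy
  have h2 := h _ (proj_spec hc hn x).1
  have h3 : ‖proj S x - y‖ ^ 2 ≤ 0 := by
    rw [← real_inner_self_eq_norm_sq]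
    simp only [inner_sub_left, inner_sub_right] at *
    linarith
  exact sub_eq_zero.1 (norm_eq_zero.1 (pow_eq_zero_iff two_ne_zero |>.1
    (le_antisymm h3 (sq_nonneg _))))

end Projection

namespace Data

variable {n m N : ℕ} (D : Data n m N)

/-! ### The condensed quadratic program -/

lemma block_add (ν ζ : Vec (Fin N × Fin m)) (i : ℕ) : block (ν + ζ) i = block ν i + block ζ i := by
  ext b; simp only [block, PiLp.add_apply]; split <;> simp

lemma block_smul (t : ℝ) (ν : Vec (Fin N × Fin m)) (i : ℕ) : block (t • ν) i = t • block ν i := by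
  ext b; simp only [block, PiLp.smul_apply]; split <;> simp

@[simp] lemma block_zero (i : ℕ) : block (0 : Vec (Fin N × Fin m)) i = 0 := by
  ext b; simp [block]

lemma continuous_block (i : ℕ) : Continuous fun ν : Vec (Fin N × Fin m) => block ν i := by
  refine (PiLp.continuous_toLp 2 _).comp (continuous_pi fun b => ?_)
  by_cases h : i < N
  · simp only [h, dite_true]; fun_prop
  · simp only [h, dite_false]; fun_prop

/-! ### Feasible inputs and definiteness of the condensed matrices. -/

variable {D}

lemma WellPosed.zero_mem (hD : D.WellPosed) : (0 : Vec (Fin N × Fin m)) ∈ D.inputs :=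
  fun i _ => by simpa using interior_subset hD.U_zero

lemma WellPosed.inputs_closed (hD : D.WellPosed) : IsClosed D.inputs := by
  have : D.inputs = ⋂ i, ⋂ _ : i < N, (fun ν => block ν i) ⁻¹' D.U := by
    ext ν; simp [inputs]
  rw [this]
  exact isClosed_iInter fun i => isClosed_iInter fun _ =>
    hD.U_closed.preimage (continuous_block i)

lemma WellPosed.inputs_convex (hD : D.WellPosed) : Convex ℝ D.inputs := by
  intro x hx y hy a b ha hb hab i hi
  rw [block_add, block_smul, block_smul]
  exact hD.U_convex (hx i hi) (hy i hi) ha hb hab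

/-- The Riccati equation writes `P` as `Q ≻ 0` plus semidefinite terms. -/
lemma WellPosed.P_pos (hD : D.WellPosed) : D.P.PosDef := by
  rw [hD.P_riccati, add_assoc]
  refine hD.Q_pos.add_posSemidef (Matrix.PosSemidef.add ?_ ?_)
  · simpa using hD.R_pos.posSemidef.conjTranspose_mul_mul_same D.K
  · simpa using hD.P_psd.conjTranspose_mul_mul_same (D.A - D.B * D.K)

lemma WellPosed.W_isHermitian (hD : D.WellPosed) : D.W.IsHermitian := by
  refine Matrix.IsHermitian.add ?_ ?_
  · simpa using Matrix.isHermitian_conjTranspose_mul_mul (D.A ^ N) hD.P_psd.isHermitian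
  · refine (Matrix.posSemidef_sum _ fun i _ => ?_).isHermitian
    simpa using hD.Q_pos.posSemidef.conjTranspose_mul_mul_same (D.A ^ i)

lemma WellPosed.H_isHermitian (hD : D.WellPosed) : D.H.IsHermitian := by
  refine Matrix.IsHermitian.add (Matrix.IsHermitian.add ?_ ?_) ?_
  · simpa using Matrix.isHermitian_conjTranspose_mul_mul (D.predict N) hD.P_psd.isHermitian
  · refine (Matrix.posSemidef_sum _ fun i _ => ?_).isHermitian
    simpa using hD.Q_pos.posSemidef.conjTranspose_mul_mul_same (D.predict i)
  · ext ja kb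
    have := hD.R_pos.isHermitian.apply kb.2 ja.2
    by_cases h : ja.1 = kb.1
    · simpa [h] using this.symm
    · simp [h, Ne.symm h]

lemma WellPosed.openCost_eq_inner (hD : D.WellPosed) (x : Vec (Fin n))
    (ν : Vec (Fin N × Fin m)) :
    D.openCost x ν = quad D.W x + 2 * ⟪ν, act D.G x⟫ + quad D.H ν := by
  rw [D.openCost_eq hD.Q_pos.isHermitian hD.P_psd.isHermitian, inner_eq_dotProduct]; rfl

lemma WellPosed.sum_stage_le_cost (hD : D.WellPosed) (T : ℕ) (x : Vec (Fin n))
    (u : ℕ → Vec (Fin m)) :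
    ∑ k ∈ Finset.range T, (quad D.Q (D.state x u k) + quad D.R (u k)) ≤ D.cost T x u :=
  le_add_of_nonneg_left (quad_nonneg hD.P_psd _)

lemma WellPosed.stage_nonneg (hD : D.WellPosed) (x : Vec (Fin n)) (u : Vec (Fin m)) :
    0 ≤ quad D.Q x + quad D.R u :=
  add_nonneg (quad_nonneg hD.Q_pos.posSemidef _) (quad_nonneg hD.R_pos.posSemidef _)

lemma WellPosed.openCost_nonneg (hD : D.WellPosed) (x : Vec (Fin n))
    (ν : Vec (Fin N × Fin m)) : 0 ≤ D.openCost x ν :=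
  (Finset.sum_nonneg fun _ _ => hD.stage_nonneg _ _).trans (hD.sum_stage_le_cost N x _)

lemma WellPosed.quad_Q_le_openCost (hD : D.WellPosed) (hN : 1 ≤ N) (x : Vec (Fin n))
    (ν : Vec (Fin N × Fin m)) : quad D.Q x ≤ D.openCost x ν := by
  refine le_trans ?_ (hD.sum_stage_le_cost N x _)
  refine le_trans ?_ (Finset.single_le_sum (fun k _ => hD.stage_nonneg _ _)
    (Finset.mem_range.2 hN))
  exact le_add_of_nonneg_right (quad_nonneg hD.R_pos.posSemidef _)

lemma WellPosed.W_pos (hD : D.WellPosed) (hN : 1 ≤ N) : D.W.PosDef := by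
  refine posDef_of_quad_pos hD.W_isHermitian fun x hx => ?_
  have := hD.quad_Q_le_openCost hN x 0
  rw [hD.openCost_eq_inner] at this
  simp only [inner_zero_left, quad_zero] at this
  linarith [quad_pos hD.Q_pos hx]

/-- `νᵀHν` is the cost from the zero state, which contains the `R`-weight of every input block. -/
lemma WellPosed.H_pos (hD : D.WellPosed) : D.H.PosDef := by
  refine posDef_of_quad_pos hD.H_isHermitian fun ν hν => ?_
  have h1 := hD.openCost_eq_inner 0 ν
  simp only [quad_zero, act_zero, inner_zero_right, mul_zero, zero_add] at h1
  rw [← h1]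
  obtain ⟨⟨j, b⟩, hj⟩ : ∃ jb, ν jb ≠ 0 := by
    by_contra! h; exact hν (by ext jb; simp [h])
  refine lt_of_lt_of_le ?_ (hD.sum_stage_le_cost N 0 _)
  refine lt_of_lt_of_le ?_ (Finset.single_le_sum (fun k _ => hD.stage_nonneg _ _)
    (Finset.mem_range.2 j.2))
  refine add_pos_of_nonneg_of_pos (quad_nonneg hD.Q_pos.posSemidef _) (quad_pos hD.R_pos ?_)
  intro h
  refine hj ?_
  simpa [block] using congrArg (fun v : Vec (Fin m) => v b) h

lemma WellPosed.continuous_openCost (hD : D.WellPosed) (x : Vec (Fin n)) :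
    Continuous (D.openCost x) := by
  have : D.openCost x = fun ν => quad D.W x + 2 * ⟪ν, act D.G x⟫ + quad D.H ν :=
    funext fun ν => hD.openCost_eq_inner x ν
  rw [this]
  unfold quad
  fun_prop

lemma WellPosed.muStar_spec (hD : D.WellPosed) (x : Vec (Fin n)) :
    D.muStar x ∈ D.inputs ∧ ∀ ν ∈ D.inputs, D.openCost x (D.muStar x) ≤ D.openCost x ν := by
  apply argminOn_spec
  obtain ⟨q, hq, hH⟩ := exists_mul_le_quad hD.H_pos
  -- Outside this ball `q‖ν‖²` dominates the linear term, so the cost exceeds its value at `0` and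
  -- it suffices to minimize over a compact set.
  set r := 2 * ‖act D.G x‖ / q
  have h0 : (0 : Vec (Fin N × Fin m)) ∈ D.inputs ∩ Metric.closedBall 0 r :=
    ⟨hD.zero_mem, by simp only [Metric.mem_closedBall, dist_self]; positivity⟩
  obtain ⟨μ, hμ, hmin⟩ := ((isCompact_closedBall (0 : Vec (Fin N × Fin m)) r).inter_left
    hD.inputs_closed).exists_isMinOn ⟨0, h0⟩ (hD.continuous_openCost x).continuousOn
  refine ⟨μ, hμ.1, fun z hz => ?_⟩
  by_cases hzr : ‖z‖ ≤ r
  · exact hmin ⟨hz, by simpa using hzr⟩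
  · refine (hmin h0).trans ?_
    rw [hD.openCost_eq_inner, hD.openCost_eq_inner]
    have h1 := abs_le.1 (abs_real_inner_le_norm z (act D.G x))
    have h2 := hH z
    have h3 : 2 * ‖act D.G x‖ < q * ‖z‖ := by
      rw [not_le, div_lt_iff₀ hq] at hzr; linarith
    simp only [inner_zero_left, quad_zero]
    nlinarith [mul_le_mul_of_nonneg_right h3.le (norm_nonneg z)]

lemma nonneg_of_quadratic_nonneg {a b : ℝ}
    (h : ∀ t : ℝ, 0 < t → t ≤ 1 → 0 ≤ 2 * t * a + t ^ 2 * b) : 0 ≤ a := by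
  by_contra! ha
  set t := min 1 (-a / (|b| + 1))
  have ht : 0 < t := lt_min one_pos (div_pos (by linarith) (by positivity))
  have h1 := h t ht (min_le_left _ _)
  have h2 : t * (|b| + 1) ≤ -a := by
    rw [← le_div_iff₀ (by positivity)]; exact min_le_right _ _
  have h3 : 0 ≤ 2 * a + t * b := by
    refine nonneg_of_mul_nonneg_right (a := t) ?_ ht
    linarith
  nlinarith [le_abs_self b]

/-- First-order optimality: moving from `μ⋆` a little towards the feasible point `z` cannot lower
the cost. The vector on the left is half the gradient. -/
lemma WellPosed.muStar_inner_nonneg (hD : D.WellPosed) (x : Vec (Fin n))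
    {z : Vec (Fin N × Fin m)} (hz : z ∈ D.inputs) :
    0 ≤ ⟪act D.H (D.muStar x) + act D.G x, z - D.muStar x⟫ := by
  obtain ⟨hμ, hmin⟩ := hD.muStar_spec x
  set μ := D.muStar x
  refine nonneg_of_quadratic_nonneg (b := quad D.H (z - μ)) fun t ht ht1 => ?_
  have hmem : μ + t • (z - μ) ∈ D.inputs := hD.inputs_convex.add_smul_sub_mem hμ hz ⟨ht.le, ht1⟩
  have h := hmin _ hmem
  rw [hD.openCost_eq_inner, hD.openCost_eq_inner, quad_add hD.H_isHermitian, quad_smul,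
    inner_add_left, inner_smul_left, inner_smul_right] at h
  simp only [conj_trivial] at h
  rw [inner_add_left, real_inner_comm (z - μ) (act D.G x)]
  linarith

/-- The optimal mapping is Lipschitz, in weighted norms. -/
lemma WellPosed.norm_sqrt_muStar_sub_le (hD : D.WellPosed) (x y : Vec (Fin n)) :
    ‖act (CFC.sqrt D.H) (D.muStar x - D.muStar y)‖ ≤ ‖act (invSqrt D.H * D.G) (x - y)‖ := by
  have h1 := hD.muStar_inner_nonneg x (hD.muStar_spec y).1
  have h2 := hD.muStar_inner_nonneg y (hD.muStar_spec x).1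
  set v := D.muStar x - D.muStar y with hv
  -- The sum of the two variational inequalities, each tested at the other minimizer.
  have h3 : quad D.H v ≤ -⟪act D.G (x - y), v⟫ := by
    rw [← neg_sub, ← hv, inner_neg_right] at h1
    rw [quad_eq_inner, real_inner_comm, hv, act_sub, act_sub, ← hv]
    simp only [inner_add_left, inner_sub_left] at *
    linarith
  have h4 : ⟪act D.G (x - y), v⟫ =
      ⟪act (invSqrt D.H * D.G) (x - y), act (CFC.sqrt D.H) v⟫ := by
    rw [mul_act, ← inner_act_symm (invSqrt_isHermitian D.H), invSqrt_act_sqrt_act hD.H_pos]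
  rw [h4, ← norm_sqrt_act_sq hD.H_pos.posSemidef] at h3
  have h5 := (abs_le.1 (abs_real_inner_le_norm (act (invSqrt D.H * D.G) (x - y))
    (act (CFC.sqrt D.H) v))).1
  rcases (norm_nonneg (act (CFC.sqrt D.H) v)).eq_or_lt with h | h
  · rw [← h]; exact norm_nonneg _
  · nlinarith

lemma WellPosed.norm_muStar_sub_le' (hD : D.WellPosed) (x y : Vec (Fin n)) :
    ‖D.muStar x - D.muStar y‖ ≤ ‖invSqrt D.H‖ * ‖act (invSqrt D.H * D.G) (x - y)‖ :=
  (norm_le_invSqrt hD.H_pos _).trans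
    (mul_le_mul_of_nonneg_left (hD.norm_sqrt_muStar_sub_le x y) (norm_nonneg _))

lemma L_nonneg : 0 ≤ D.L := mul_nonneg (norm_nonneg _) (norm_nonneg _)

lemma WellPosed.norm_muStar_sub_le (hD : D.WellPosed) (x y : Vec (Fin n)) :
    ‖D.muStar x - D.muStar y‖ ≤ D.L * ‖x - y‖ := by
  refine (hD.norm_muStar_sub_le' x y).trans ?_
  rw [L, mul_assoc]
  exact mul_le_mul_of_nonneg_left (norm_act_le _ _) (norm_nonneg _)

/-- Strict convexity: expanded around `μ⋆`, the cost has a nonnegative linear term on the feasible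
set and a positive definite quadratic one. -/
lemma WellPosed.muStar_eq_of_openCost_le (hD : D.WellPosed) {x : Vec (Fin n)}
    {ν : Vec (Fin N × Fin m)} (hν : ν ∈ D.inputs) (h : D.openCost x ν ≤ D.openCost x (D.muStar x)) :
    D.muStar x = ν := by
  have h1 := hD.muStar_inner_nonneg x hν
  set μ := D.muStar x
  have h2 : D.openCost x ν = D.openCost x μ + 2 * ⟪act D.H μ + act D.G x, ν - μ⟫ +
      quad D.H (ν - μ) := by
    conv_lhs => rw [show ν = μ + (ν - μ) by abel]
    rw [hD.openCost_eq_inner, hD.openCost_eq_inner, quad_add hD.H_isHermitian, inner_add_left,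
      inner_add_left, real_inner_comm (ν - μ) (act D.G x)]
    ring
  by_contra hne
  have := quad_pos hD.H_pos (sub_ne_zero.2 (Ne.symm hne))
  linarith

@[simp] lemma WellPosed.muStar_zero (hD : D.WellPosed) : D.muStar 0 = 0 := by
  refine hD.muStar_eq_of_openCost_le hD.zero_mem ?_
  have : D.openCost 0 (0 : Vec (Fin N × Fin m)) = 0 := by rw [hD.openCost_eq_inner]; simp
  rw [this]
  exact hD.openCost_nonneg _ _

lemma WellPosed.norm_muStar_le (hD : D.WellPosed) (x : Vec (Fin n)) :
    ‖D.muStar x‖ ≤ D.L * ‖x‖ := by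
  simpa [hD.muStar_zero] using hD.norm_muStar_sub_le x 0

/-! ### The optimal value -/

lemma psi_nonneg (x : Vec (Fin n)) : 0 ≤ D.psi x := Real.sqrt_nonneg _

lemma WellPosed.psi_sq (hD : D.WellPosed) (x : Vec (Fin n)) :
    D.psi x ^ 2 = D.openCost x (D.muStar x) := Real.sq_sqrt (hD.openCost_nonneg _ _)

lemma WellPosed.psi_sq_le (hD : D.WellPosed) {x : Vec (Fin n)} {ν : Vec (Fin N × Fin m)}
    (hν : ν ∈ D.inputs) : D.psi x ^ 2 ≤ D.openCost x ν := by
  rw [hD.psi_sq]; exact (hD.muStar_spec x).2 ν hν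

lemma WellPosed.openCost_zero_right (hD : D.WellPosed) (x : Vec (Fin n)) :
    D.openCost x 0 = quad D.W x := by
  rw [hD.openCost_eq_inner]; simp

lemma WellPosed.psi_le_sqrt_quad (hD : D.WellPosed) (x : Vec (Fin n)) :
    D.psi x ≤ √(quad D.W x) := by
  refine Real.le_sqrt_of_sq_le ?_
  rw [← hD.openCost_zero_right]; exact hD.psi_sq_le hD.zero_mem

/-- The square root of the cost is a seminorm in the pair `(x, ν)`. The required Cauchy-Schwarz
inequality is read off the discriminant of the nonnegative polynomial `t ↦ J_N(x + t w, ν)`. -/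
lemma WellPosed.openCost_add_le (hD : D.WellPosed) (x w : Vec (Fin n))
    (ν : Vec (Fin N × Fin m)) :
    √(D.openCost (x + w) ν) ≤ √(D.openCost x ν) + √(quad D.W w) := by
  set c := ⟪act D.W x, w⟫ + ⟪ν, act D.G w⟫ with hc
  have h1 : ∀ t : ℝ, D.openCost (x + t • w) ν =
      quad D.W w * (t * t) + 2 * c * t + D.openCost x ν := by
    intro t
    rw [hD.openCost_eq_inner, hD.openCost_eq_inner, quad_add hD.W_isHermitian, quad_smul,
      act_add, act_smul, inner_add_right, inner_smul_right, inner_smul_right, hc]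
    ring
  have h2 := discrim_le_zero fun t => (h1 t) ▸ hD.openCost_nonneg (x + t • w) ν
  have h3 := h1 1
  have h4 : 0 ≤ quad D.W w := by
    rw [← hD.openCost_zero_right]; exact hD.openCost_nonneg _ _
  have h5 := hD.openCost_nonneg x ν
  have h6 : c ≤ √(D.openCost x ν) * √(quad D.W w) := by
    rw [← Real.sqrt_mul h5]
    refine Real.le_sqrt_of_sq_le ?_
    rw [discrim] at h2; nlinarith
  rw [one_smul] at h3
  refine Real.sqrt_le_iff.2 ⟨by positivity, ?_⟩
  rw [h3]
  nlinarith [Real.sq_sqrt h4, Real.sq_sqrt h5]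

lemma WellPosed.psi_add_le (hD : D.WellPosed) (x w : Vec (Fin n)) :
    D.psi (x + w) ≤ D.psi x + √(quad D.W w) :=
  (Real.sqrt_le_sqrt ((hD.muStar_spec (x + w)).2 _ (hD.muStar_spec x).1)).trans
    (hD.openCost_add_le x w _)

/-- The variational inequality tested at `z = 0`. This is the source of the factor `λ_P⁺(W) - 1` in
`κ`. -/
lemma WellPosed.quad_muStar_le (hD : D.WellPosed) (x : Vec (Fin n)) :
    quad D.H (D.muStar x) ≤ quad D.W x - D.psi x ^ 2 := by
  have h := hD.muStar_inner_nonneg x hD.zero_mem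
  rw [hD.psi_sq, hD.openCost_eq_inner]
  rw [zero_sub, inner_neg_right, inner_add_left, real_inner_comm _ (act D.G x),
    real_inner_comm _ (act D.H _), ← quad_eq_inner] at h
  linarith

lemma WellPosed.exists_norm_le_psi (hD : D.WellPosed) (hN : 1 ≤ N) :
    ∃ b > 0, ∀ x, ‖x‖ ≤ b * D.psi x := by
  obtain ⟨q, hq, h⟩ := exists_mul_le_quad hD.Q_pos
  refine ⟨(√q)⁻¹, by positivity, fun x => ?_⟩
  have h1 := (h x).trans (hD.quad_Q_le_openCost hN x (D.muStar x))
  rw [← hD.psi_sq] at h1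
  rw [inv_mul_eq_div, le_div_iff₀ (by positivity)]
  refine abs_le_of_sq_le_sq' ?_ (psi_nonneg x) |>.2
  rw [mul_pow, Real.sq_sqrt hq.le]; linarith

/-! ### The projected gradient method -/

lemma WellPosed.gradient_openCost (hD : D.WellPosed) (x : Vec (Fin n))
    (ν : Vec (Fin N × Fin m)) :
    gradient (D.openCost x) ν = (2 : ℝ) • (act D.H ν + act D.G x) := by
  refine HasGradientAt.gradient ?_
  rw [hasGradientAt_iff_isLittleO]
  -- The first-order remainder of a quadratic is exactly its quadratic part.
  have h : ∀ z, D.openCost x z - D.openCost x ν - ⟪(2 : ℝ) • (act D.H ν + act D.G x), z - ν⟫ =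
      quad D.H (z - ν) := by
    intro z
    have h2 := quad_add hD.H_isHermitian ν (z - ν)
    rw [add_sub_cancel] at h2
    rw [hD.openCost_eq_inner, hD.openCost_eq_inner, h2, inner_smul_left, inner_add_left,
      inner_sub_right (act D.G x), real_inner_comm z (act D.G x),
      real_inner_comm ν (act D.G x)]
    simp only [conj_trivial]
    ring
  simp only [h]
  refine (Asymptotics.IsBigO.of_bound ‖D.H‖ (Filter.Eventually.of_forall fun z => ?_)).trans_isLittleO
    (g := fun z => ‖z - ν‖ ^ 2) ?_
  · have := abs_quad_sub_le D.H (z - ν) 0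
    simp only [quad_zero, sub_zero, norm_zero, add_zero] at this
    rw [Real.norm_eq_abs, norm_pow, norm_norm]
    linarith [this]
  · have h3 := Asymptotics.isLittleO_norm_pow_id (one_lt_two) (E' := Vec (Fin N × Fin m))
    have h4 : Filter.Tendsto (fun z => z - ν) (nhds ν) (nhds 0) := by
      have : Continuous fun z => z - ν := by fun_prop
      simpa using this.tendsto ν
    exact h3.comp_tendsto h4

lemma WellPosed.eta_nonneg (hD : D.WellPosed) : 0 ≤ D.eta :=
  div_nonneg (sub_nonneg.2 (lamMin_le_lamMax hD.H_pos.posSemidef))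
    (add_nonneg (lamMax_nonneg hD.H_pos.posSemidef) (lamMin_nonneg hD.H_pos.posSemidef))

lemma WellPosed.eta_lt_one (hD : D.WellPosed) : D.eta < 1 := by
  rcases isEmpty_or_nonempty (Fin N × Fin m) with h | h
  · simp [eta, lamMax, lamMin]
  · have h1 := lamMin_pos hD.H_pos
    have h2 := lamMin_le_lamMax hD.H_pos.posSemidef
    rw [eta, div_lt_one (by linarith)]
    linarith

/-- The gradient carries a factor `2`, so the effective step on `H` is `2 / (λ⁺ + λ⁻)`, the
classical optimal one. The difference of the squared sides is a nonnegative multiple of the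
expression in `norm_act_sq_le`, with sign reversed. -/
lemma WellPosed.norm_sub_act_le (hD : D.WellPosed) (v : Vec (Fin N × Fin m)) :
    ‖v - (2 * D.stepSize) • act D.H v‖ ≤ D.eta * ‖v‖ := by
  rcases isEmpty_or_nonempty (Fin N × Fin m) with h | h
  · rw [Subsingleton.elim (v - _) 0, norm_zero]
    exact mul_nonneg hD.eta_nonneg (norm_nonneg _)
  have h1 := lamMin_pos hD.H_pos
  have h2 := lamMin_le_lamMax hD.H_pos.posSemidef
  have h3 := norm_act_sq_le hD.H_isHermitian v
  refine abs_le_of_sq_le_sq' ?_ (mul_nonneg hD.eta_nonneg (norm_nonneg _)) |>.2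
  rw [norm_sub_sq_real, norm_smul, inner_smul_right, ← quad_eq_inner, mul_pow, mul_pow,
    Real.norm_eq_abs, sq_abs, stepSize, eta]
  have hs : 0 < lamMax D.H + lamMin D.H := by linarith
  rw [div_pow, ← sub_nonneg]
  have : 0 ≤ 4 * -(‖act D.H v‖ ^ 2 - (lamMax D.H + lamMin D.H) * quad D.H v +
      lamMax D.H * lamMin D.H * ‖v‖ ^ 2) / (lamMax D.H + lamMin D.H) ^ 2 := by
    apply div_nonneg _ (by positivity); linarith
  refine this.trans (le_of_eq ?_)
  field_simp
  ring

lemma WellPosed.pgm_muStar (hD : D.WellPosed) (x : Vec (Fin n)) :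
    D.pgm x (D.muStar x) = D.muStar x := by
  refine proj_eq_of_inner_le hD.inputs_closed hD.inputs_convex ⟨0, hD.zero_mem⟩
    (hD.muStar_spec x).1 fun z hz => ?_
  have h := hD.muStar_inner_nonneg x hz
  have hs : 0 ≤ D.stepSize := one_div_nonneg.2
    (add_nonneg (lamMax_nonneg hD.H_pos.posSemidef) (lamMin_nonneg hD.H_pos.posSemidef))
  rw [hD.gradient_openCost, sub_sub_cancel_left, inner_neg_left, inner_smul_left, inner_smul_left]
  simp only [conj_trivial, Left.neg_nonpos_iff]
  positivity

lemma WellPosed.norm_pgm_sub_le (hD : D.WellPosed) (x : Vec (Fin n))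
    (ν : Vec (Fin N × Fin m)) : ‖D.pgm x ν - D.muStar x‖ ≤ D.eta * ‖ν - D.muStar x‖ := by
  nth_rw 1 [← hD.pgm_muStar x]
  refine (norm_proj_sub_proj_le hD.inputs_closed hD.inputs_convex ⟨0, hD.zero_mem⟩ _ _).trans ?_
  refine le_trans (le_of_eq ?_) (hD.norm_sub_act_le _)
  rw [hD.gradient_openCost, hD.gradient_openCost, act_sub]
  congr 1
  module

lemma WellPosed.norm_iterate_pgm_sub_le (hD : D.WellPosed) (x : Vec (Fin n))
    (ν : Vec (Fin N × Fin m)) (k : ℕ) :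
    ‖(D.pgm x)^[k] ν - D.muStar x‖ ≤ D.eta ^ k * ‖ν - D.muStar x‖ := by
  induction k with
  | zero => simp
  | succ k ih =>
    rw [Function.iterate_succ_apply', pow_succ', mul_assoc]
    exact (hD.norm_pgm_sub_le x _).trans (mul_le_mul_of_nonneg_left ih hD.eta_nonneg)

lemma WellPosed.iterate_pgm_mem (hD : D.WellPosed) (x : Vec (Fin n))
    {ν : Vec (Fin N × Fin m)} (hν : ν ∈ D.inputs) (k : ℕ) : (D.pgm x)^[k] ν ∈ D.inputs := by
  cases k with
  | zero => exact hν
  | succ k =>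
    rw [Function.iterate_succ_apply']
    exact (proj_spec hD.inputs_closed ⟨0, hD.zero_mem⟩ _).1

end Data

namespace Data

variable {n m N : ℕ} {D : Data n m N}

/-! ### Completion of squares and the Riccati equation -/

lemma exists_mul_quad_le_quad {ι : Type} [Fintype ι] [DecidableEq ι] {M : Matrix ι ι ℝ}
    (hM : M.PosDef) (V : Matrix ι ι ℝ) :
    ∃ δ, 0 < δ ∧ δ < 1 ∧ ∀ x : Vec ι, δ * quad V x ≤ quad M x := by
  obtain ⟨q, hq, h⟩ := exists_mul_le_quad hM
  have hV := norm_nonneg V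
  have hpos : 0 < ‖V‖ + q + 1 := by positivity
  refine ⟨q / (‖V‖ + q + 1), by positivity, by rw [div_lt_one hpos]; linarith, fun x => ?_⟩
  have h1 := abs_quad_sub_le V x 0
  simp only [quad_zero, sub_zero, norm_zero, add_zero] at h1
  refine le_trans ?_ (h x)
  rw [div_mul_eq_mul_div, div_le_iff₀ hpos]
  have h2 : quad V x ≤ (‖V‖ + q + 1) * ‖x‖ ^ 2 := by
    nlinarith [le_abs_self (quad V x), sq_nonneg ‖x‖]
  nlinarith

/-- The matrix `R + Bᵀ P B`. -/
def inputWeight (D : Data n m N) : Matrix (Fin m) (Fin m) ℝ := D.R + D.Bᵀ * D.P * D.B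

lemma WellPosed.inputWeight_pos (hD : D.WellPosed) : D.inputWeight.PosDef := by
  refine hD.R_pos.add_posSemidef ?_
  simpa using hD.P_psd.conjTranspose_mul_mul_same D.B

lemma WellPosed.inputWeight_mul_K (hD : D.WellPosed) : D.inputWeight * D.K = D.Bᵀ * D.P * D.A := by
  rw [K, ← inputWeight, ← Matrix.mul_assoc,
    Matrix.mul_nonsing_inv _ (isUnit_iff_ne_zero.2 hD.inputWeight_pos.det_pos.ne'),
    Matrix.one_mul]

lemma WellPosed.quad_P_eq (hD : D.WellPosed) (x : Vec (Fin n)) :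
    quad D.P x =
      quad D.Q x + quad D.R (act D.K x) + quad D.P (act (D.A - D.B * D.K) x) := by
  conv_lhs => rw [hD.P_riccati]
  rw [quad_matrix_add, quad_matrix_add, quad_congr, quad_congr]

/-- Completion of the square in `u`. The cross terms cancel because the Riccati gain satisfies `Bᵀ P
(A - B K) = R K`. -/
lemma WellPosed.quad_step (hD : D.WellPosed) (x : Vec (Fin n)) (u : Vec (Fin m)) :
    quad D.P (act D.A x + act D.B u) + quad D.Q x + quad D.R u =
      quad D.P x + quad D.inputWeight (u + act D.K x) := by
  set v := u + act D.K x with hv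
  have hu : u = v + -act D.K x := by rw [hv]; abel
  have h1 : act D.A x + act D.B u = act (D.A - D.B * D.K) x + act D.B v := by
    rw [hu, act_add, act_neg, sub_act, mul_act]; abel
  have h2 : D.Bᵀ * D.P * (D.A - D.B * D.K) = D.R * D.K := by
    have := hD.inputWeight_mul_K
    rw [inputWeight, Matrix.add_mul] at this
    rw [Matrix.mul_sub, ← this, ← Matrix.mul_assoc, add_sub_cancel_right]
  have h3 : ⟪act D.P (act (D.A - D.B * D.K) x), act D.B v⟫ = ⟪act D.R (act D.K x), v⟫ := by
    rw [inner_act, ← mul_act, ← mul_act, h2, mul_act]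
  have h4 : ⟪act D.R v, act D.K x⟫ = ⟪act D.R (act D.K x), v⟫ := by
    rw [← inner_act_symm hD.R_pos.isHermitian, real_inner_comm]
  rw [h1, quad_add hD.P_psd.isHermitian, h3, hu, quad_add hD.R_pos.isHermitian, quad_neg,
    inner_neg_right, h4, hD.quad_P_eq x, inputWeight, quad_matrix_add, quad_congr]
  ring

lemma WellPosed.quad_P_feedback (hD : D.WellPosed) (x : Vec (Fin n)) :
    quad D.P (act D.A x + act D.B (-act D.K x)) + quad D.Q x ≤ quad D.P x := by
  have h := hD.quad_step x (-act D.K x)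
  rw [neg_add_cancel, quad_zero] at h
  linarith [quad_nonneg hD.R_pos.posSemidef (-act D.K x)]

/-- Lengthening the horizon costs only the squared deviation of the new input from feedback.
Iterating shows that `‖x‖²_P` is a lower bound for the cost and that a feedback tail is free. -/
lemma WellPosed.cost_succ (hD : D.WellPosed) (T : ℕ) (x : Vec (Fin n)) (u : ℕ → Vec (Fin m)) :
    D.cost (T + 1) x u =
      D.cost T x u + quad D.inputWeight (u T + act D.K (D.state x u T)) := by
  have h := hD.quad_step (D.state x u T) (u T)
  rw [cost, cost, Finset.sum_range_succ, state]
  linarith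

lemma state_shift (x : Vec (Fin n)) (u : ℕ → Vec (Fin m)) (k : ℕ) :
    D.state x u (k + 1) = D.state (act D.A x + act D.B (u 0)) (fun j => u (j + 1)) k := by
  induction k with
  | zero => rfl
  | succ k ih => rw [state, ih]; rfl

lemma cost_shift (T : ℕ) (x : Vec (Fin n)) (u : ℕ → Vec (Fin m)) :
    D.cost (T + 1) x u = quad D.Q x + quad D.R (u 0) +
      D.cost T (act D.A x + act D.B (u 0)) (fun j => u (j + 1)) := by
  simp only [cost, Finset.sum_range_succ', state_shift]
  simp only [state]
  ring

lemma state_congr {x : Vec (Fin n)} {u v : ℕ → Vec (Fin m)} {k : ℕ} (h : ∀ j < k, u j = v j) :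
    D.state x u k = D.state x v k := by
  induction k with
  | zero => rfl
  | succ k ih => rw [state, state, ih fun j hj => h j (hj.trans k.lt_succ_self), h k k.lt_succ_self]

lemma cost_congr {T : ℕ} {x : Vec (Fin n)} {u v : ℕ → Vec (Fin m)} (h : ∀ j < T, u j = v j) :
    D.cost T x u = D.cost T x v := by
  rw [cost, cost, state_congr h]
  congr 1
  refine Finset.sum_congr rfl fun k hk => ?_
  have hk := Finset.mem_range.1 hk
  rw [h k hk, state_congr fun j hj => h j (hj.trans hk)]

lemma WellPosed.quad_P_le_cost (hD : D.WellPosed) (T : ℕ) (x : Vec (Fin n))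
    (u : ℕ → Vec (Fin m)) : quad D.P x ≤ D.cost T x u := by
  induction T with
  | zero => simp [cost, state]
  | succ T ih =>
    rw [hD.cost_succ]
    exact ih.trans (le_add_of_nonneg_right (quad_nonneg hD.inputWeight_pos.posSemidef _))

lemma WellPosed.quad_P_le_psi_sq (hD : D.WellPosed) (x : Vec (Fin n)) :
    quad D.P x ≤ D.psi x ^ 2 := by
  rw [hD.psi_sq]; exact hD.quad_P_le_cost N x _

/-! ### Switching to the linear-quadratic regulator -/

/-- The trajectory that follows the inputs `u` before time `i` and linear feedback afterwards. -/
def switchState (D : Data n m N) (x : Vec (Fin n)) (u : ℕ → Vec (Fin m)) (i : ℕ) :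
    ℕ → Vec (Fin n)
  | 0 => x
  | k + 1 => act D.A (switchState D x u i k) +
      act D.B (if k < i then u k else -act D.K (switchState D x u i k))

/-- The inputs that equal `u` before time `i` and linear feedback afterwards. -/
def switchInput (D : Data n m N) (x : Vec (Fin n)) (u : ℕ → Vec (Fin m)) (i k : ℕ) :
    Vec (Fin m) :=
  if k < i then u k else -act D.K (D.switchState x u i k)

lemma state_switchInput (x : Vec (Fin n)) (u : ℕ → Vec (Fin m)) (i k : ℕ) :
    D.state x (D.switchInput x u i) k = D.switchState x u i k := by
  induction k with
  | zero => rfl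
  | succ k ih => rw [state, ih]; rfl

lemma switchInput_of_lt (x : Vec (Fin n)) (u : ℕ → Vec (Fin m)) {i k : ℕ} (h : k < i) :
    D.switchInput x u i k = u k := if_pos h

lemma switchInput_of_le (x : Vec (Fin n)) (u : ℕ → Vec (Fin m)) {i k : ℕ} (h : i ≤ k) :
    D.switchInput x u i k = -act D.K (D.state x (D.switchInput x u i) k) := by
  rw [state_switchInput]; exact if_neg (not_lt.2 h)

lemma WellPosed.quad_P_switch_le (hD : D.WellPosed) (x : Vec (Fin n)) (u : ℕ → Vec (Fin m))
    {i k : ℕ} (h : i ≤ k) :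
    quad D.P (D.state x (D.switchInput x u i) k) ≤ quad D.P (D.state x u i) := by
  induction k, h using Nat.le_induction with
  | base => rw [state_congr fun j hj => switchInput_of_lt x u hj]
  | succ k hk ih =>
    rw [state, switchInput_of_le x u hk]
    have := hD.quad_P_feedback (D.state x (D.switchInput x u i) k)
    linarith [quad_nonneg hD.Q_pos.posSemidef (D.state x (D.switchInput x u i) k)]

lemma WellPosed.cost_switch (hD : D.WellPosed) (x : Vec (Fin n)) (u : ℕ → Vec (Fin m))
    {i T : ℕ} (h : i ≤ T) : D.cost T x (D.switchInput x u i) = D.cost i x u := by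
  induction T, h using Nat.le_induction with
  | base => exact cost_congr fun j hj => switchInput_of_lt x u hj
  | succ T hT ih =>
    rw [hD.cost_succ, switchInput_of_le x u hT, neg_add_cancel, quad_zero, add_zero, ih]

lemma WellPosed.switchInput_mem (hD : D.WellPosed) {c : ℝ} (hc : D.IsLevel c) (x : Vec (Fin n))
    (u : ℕ → Vec (Fin m)) {i k : ℕ} (h : i ≤ k) (hi : quad D.P (D.state x u i) ≤ c) :
    D.switchInput x u i k ∈ D.U := by
  rw [switchInput_of_le x u h]
  exact hc.2 ((hD.quad_P_switch_le x u h).trans hi)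

/-- The stacked vector of the first `N` terms of an input sequence. -/
def stack (N : ℕ) (u : ℕ → Vec (Fin m)) : Vec (Fin N × Fin m) :=
  WithLp.toLp 2 fun jb => u jb.1 jb.2

lemma block_stack (u : ℕ → Vec (Fin m)) {i : ℕ} (h : i < N) : block (stack N u) i = u i := by
  ext b; simp [block, stack, h]

lemma stack_mem {u : ℕ → Vec (Fin m)} (h : ∀ i < N, u i ∈ D.U) : stack N u ∈ D.inputs :=
  fun i hi => by rw [block_stack u hi]; exact h i hi

lemma openCost_stack (x : Vec (Fin n)) (u : ℕ → Vec (Fin m)) :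
    D.openCost x (stack N u) = D.cost N x u :=
  cost_congr fun _ hj => block_stack u hj

lemma act_S (hN : 1 ≤ N) (ν : Vec (Fin N × Fin m)) : act (S m N) ν = block ν 0 := by
  ext b
  have h0 : 0 < N := hN
  simp only [act, S, block, Matrix.mulVec, dotProduct, Matrix.of_apply, Fintype.sum_prod_type,
    h0, dite_true]
  rw [Finset.sum_eq_single ⟨0, h0⟩]
  · simp
  · intro j _ hj
    have : (j : ℕ) ≠ 0 := fun e => hj (Fin.ext e)
    simp [this]
  · simp

lemma f_eq (hN : 1 ≤ N) (x : Vec (Fin n)) :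
    D.f x = act D.A x + act D.B (block (D.muStar x) 0) := by
  rw [f, Bbar, mul_act, act_S hN]

/-! ### Optimal MPC is linear near the origin -/

/-- The feedback inputs remain feasible because `‖·‖²_P` does not increase along them, and they
attain the lower bound `‖x‖²_P`. Uniqueness of the minimizer identifies them with `μ⋆`. -/
lemma WellPosed.f_eq_feedback (hD : D.WellPosed) (hN : 1 ≤ N) {c : ℝ} (hc : D.IsLevel c)
    {x : Vec (Fin n)} (hx : quad D.P x ≤ c) : D.f x = act D.A x + act D.B (-act D.K x) := by
  set v := D.switchInput x 0 0 with hv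
  have hmem : stack N v ∈ D.inputs :=
    stack_mem fun i _ => hD.switchInput_mem hc x 0 i.zero_le hx
  have hcost : D.openCost x (stack N v) = quad D.P x := by
    rw [openCost_stack, hD.cost_switch x 0 N.zero_le]; simp [cost, state]
  rw [f_eq hN, hD.muStar_eq_of_openCost_le hmem (by rw [hcost]; exact hD.quad_P_le_cost N x _),
    block_stack v hN, hv, switchInput_of_le x 0 le_rfl]
  rfl

/-! ### The terminal state and the decay of the optimal value -/

/-- Once a prediction is in `Ω`, switching to feedback is feasible and leaves `‖x_i‖²_P` as the
entire remaining cost. By optimality the terminal cost of the original prediction cannot be larger.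
-/
lemma WellPosed.terminal_le_of_level (hD : D.WellPosed) {c : ℝ} (hc : D.IsLevel c)
    (x : Vec (Fin n)) {i : ℕ} (hi : i ≤ N)
    (h : quad D.P (D.state x (block (D.muStar x)) i) ≤ c) :
    quad D.P (D.state x (block (D.muStar x)) N) ≤ c := by
  set u := block (D.muStar x) with hu
  have hmem : stack N (D.switchInput x u i) ∈ D.inputs := by
    refine stack_mem fun k hk => ?_
    rcases lt_or_ge k i with hki | hki
    · rw [switchInput_of_lt x u hki]; exact (hD.muStar_spec x).1 k hk
    · exact hD.switchInput_mem hc x u hki h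
  have h1 := (hD.muStar_spec x).2 _ hmem
  rw [openCost_stack, hD.cost_switch x u hi, openCost, ← hu, cost, cost,
    ← Finset.sum_range_add_sum_Ico _ hi] at h1
  have h2 : 0 ≤ ∑ k ∈ Finset.Ico i N, (quad D.Q (D.state x u k) + quad D.R (u k)) :=
    Finset.sum_nonneg fun k _ => hD.stage_nonneg _ _
  linarith

lemma WellPosed.rN_sq (hD : D.WellPosed) {c : ℝ} (hc : D.IsLevel c) :
    D.rN c ^ 2 = N * (c * (lamMin D.Q / lamMax D.P)) + c := by
  have := hc.1.le
  have h1 := lamMin_nonneg hD.Q_pos.posSemidef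
  have h2 := lamMax_nonneg hD.P_psd
  exact Real.sq_sqrt (by positivity)

/-- If the prediction ended outside `Ω`, all its earlier states would lie outside too. Each would
then cost at least `c λ⁻(Q) / λ⁺(P)` and the last one more than `c`, contradicting `ψ(x) ≤ r_N`; the
radius `r_N` is chosen for this. -/
lemma WellPosed.terminal_le (hD : D.WellPosed) {c : ℝ} (hc : D.IsLevel c) {x : Vec (Fin n)}
    (hx : x ∈ D.Gam c) : quad D.P (D.state x (block (D.muStar x)) N) ≤ c := by
  by_contra! hlt
  set u := block (D.muStar x) with hu
  have hout : ∀ i < N, c * (lamMin D.Q / lamMax D.P) ≤ quad D.Q (D.state x u i) := by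
    intro i hi
    have h1 : c < quad D.P (D.state x u i) := by
      by_contra! h
      exact hlt.not_ge (hD.terminal_le_of_level hc x hi.le h)
    have h2 := h1.trans_le (quad_le_lamMax_mul hD.P_psd.isHermitian _)
    have h3 := lamMin_mul_le_quad hD.Q_pos.isHermitian (D.state x u i)
    have h4 : 0 < lamMax D.P := by
      refine pos_of_mul_pos_left (hc.1.trans h2) (sq_nonneg _)
    refine le_trans ?_ h3
    rw [mul_div_assoc', div_le_iff₀ h4]
    nlinarith [lamMin_nonneg hD.Q_pos.posSemidef]
  have h1 : D.psi x ^ 2 ≤ D.rN c ^ 2 := pow_le_pow_left₀ (psi_nonneg x) hx 2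
  rw [hD.rN_sq hc, hD.psi_sq, openCost, cost, ← hu] at h1
  have h2 : ∑ k ∈ Finset.range N, c * (lamMin D.Q / lamMax D.P) ≤
      ∑ k ∈ Finset.range N, (quad D.Q (D.state x u k) + quad D.R (u k)) :=
    Finset.sum_le_sum fun k hk => (hout k (Finset.mem_range.1 hk)).trans
      (le_add_of_nonneg_right (quad_nonneg hD.R_pos.posSemidef _))
  rw [Finset.sum_const, Finset.card_range, nsmul_eq_mul] at h2
  linarith

/-- The candidate at `f x` is the old optimal sequence without its first input, extended by one
feedback step. That step is feasible by `terminal_le` and does not change the total cost. -/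
lemma WellPosed.psi_f_sq_le (hD : D.WellPosed) (hN : 1 ≤ N) {c : ℝ} (hc : D.IsLevel c)
    {x : Vec (Fin n)} (hx : x ∈ D.Gam c) : D.psi (D.f x) ^ 2 ≤ D.psi x ^ 2 - quad D.Q x := by
  set u := block (D.muStar x) with hu
  set v := D.switchInput x u N with hv
  have hv0 : v 0 = u 0 := switchInput_of_lt x u hN
  have hmem : stack N (fun j => v (j + 1)) ∈ D.inputs := by
    refine stack_mem fun k hk => ?_
    rcases lt_or_ge (k + 1) N with h | h
    · rw [hv, switchInput_of_lt x u h]; exact (hD.muStar_spec x).1 _ h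
    · exact hD.switchInput_mem hc x u h (hD.terminal_le hc hx)
  have h1 := hD.psi_sq_le (x := D.f x) hmem
  have h2 := cost_shift (D := D) N x v
  have h3 : D.psi x ^ 2 = D.cost N x u := hD.psi_sq x
  rw [hv, hD.cost_switch x u N.le_succ, ← h3, ← hv, hv0, hu, ← f_eq hN, ← openCost_stack] at h2
  linarith [quad_nonneg hD.R_pos.posSemidef (block (D.muStar x) 0)]

lemma WellPosed.exists_isDecayRate (hD : D.WellPosed) (hN : 1 ≤ N) {c : ℝ} (hc : D.IsLevel c) :
    ∃ β, D.IsDecayRate c β := by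
  -- `δ W ⪯ Q` and `ψ² ≤ ‖x‖²_W` turn the decrease by `‖x‖²_Q` into the factor `1 - δ`.
  obtain ⟨δ, h0, h1, h⟩ := exists_mul_quad_le_quad hD.Q_pos D.W
  refine ⟨√(1 - δ), Real.sqrt_pos.2 (by linarith), ?_, fun x hx => ?_⟩
  · rw [Real.sqrt_lt' one_pos]; linarith
  · have h2 := hD.psi_f_sq_le hN hc hx
    have h3 : D.psi x ^ 2 ≤ quad D.W x := by
      rw [← hD.openCost_zero_right]; exact hD.psi_sq_le hD.zero_mem
    refine abs_le_of_sq_le_sq' ?_ (mul_nonneg (Real.sqrt_nonneg _) (psi_nonneg x)) |>.2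
    rw [mul_pow, Real.sq_sqrt (by linarith)]
    nlinarith [h x]

end Data

/-! ### Incremental stability of locally contracting systems -/

lemma sum_pow_mul_succ (ρ : ℝ) (w : ℕ → ℝ) (k : ℕ) :
    ∑ i ∈ Finset.range (k + 1), ρ ^ (k + 1 - i - 1) * w i =
      ρ * ∑ i ∈ Finset.range k, ρ ^ (k - i - 1) * w i + w k := by
  rw [Finset.sum_range_succ, Finset.mul_sum]
  congr 1
  · refine Finset.sum_congr rfl fun i hi => ?_
    have hi := Finset.mem_range.1 hi
    rw [show k + 1 - i - 1 = (k - i - 1) + 1 by omega, pow_succ]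
    ring
  · simp

/-- A Lipschitz system on a bounded invariant set is exponentially incrementally input-to-state
stable, for disturbances of any size, if it contracts a norm `p` on a set which all trajectories
reach within `τ` steps as long as the disturbances stay below a threshold `ε`. -/
lemma exists_isEDeltaISS {E : Type} [NormedAddCommGroup E] {f : E → E} {D Ω : Set E}
    {p : E → ℝ} {a b Λ γ M ε : ℝ} {τ : ℕ} (ha : 0 < a) (hb : 0 < b) (hΛ : 1 ≤ Λ) (hγ : 0 < γ)
    (hγ1 : γ < 1) (hε : 0 < ε) (hp_nonneg : ∀ v, 0 ≤ p v)
    (hp_sub : ∀ u v, p (u - v) ≤ p u + p v) (hp_le : ∀ v, p v ≤ a * ‖v‖)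
    (hp_ge : ∀ v, ‖v‖ ≤ b * p v) (hinv : Set.MapsTo f D D)
    (hlip : ∀ x ∈ D, ∀ y ∈ D, p (f x - f y) ≤ Λ * p (x - y))
    (hcontr : ∀ x ∈ Ω, ∀ y ∈ Ω, p (f x - f y) ≤ γ * p (x - y))
    (hbdd : ∀ x ∈ D, ∀ y ∈ D, p (x - y) ≤ M)
    (hattr : ∀ y w : ℕ → E, (∀ k, y (k + 1) = f (y k) + w k) → (∀ k, y k ∈ D) →
      ∀ k, (∀ i < τ, ‖w (k + i)‖ ≤ ε) → y (k + τ) ∈ Ω)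
    {r : ℝ} (hr : 0 < r) : ∃ c₀ cw, IsEDeltaISS f D c₀ cw r γ := by
  -- Writing `Λ = q γ` lets at most `τ` uncontrolled steps be booked as decay at rate `γ`, at the
  -- price of the factor `q ^ τ`.
  set q := Λ / γ with hq
  have hq1 : 1 ≤ q := by rw [hq, le_div_iff₀ hγ]; linarith
  have hqγ : q * γ = Λ := div_mul_cancel₀ _ hγ.ne'
  -- The second summand ensures that one disturbance larger than `ε` during the last `τ` steps
  -- already pays for the whole diameter bound `M`.
  set Cw := a * q ^ τ + |M| / (γ ^ τ * ε) with hCw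
  have haq : a ≤ a * q ^ τ := le_mul_of_one_le_right ha.le (one_le_pow₀ hq1)
  have hM : 0 ≤ |M| / (γ ^ τ * ε) := by positivity
  have hCw0 : 0 < Cw := by linarith
  refine ⟨b * (q ^ τ * a), b * Cw, hinv, by positivity, by positivity, hr, hγ, hγ1, ?_⟩
  intro x y w hx hy hx0 hyD _
  have hxD : ∀ k, x k ∈ D := by
    intro k
    induction k with
    | zero => exact hx0
    | succ k ih => rw [hx]; exact hinv ih
  set S : ℕ → ℝ := fun k => ∑ i ∈ Finset.range k, γ ^ (k - i - 1) * ‖w i‖ with hS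
  have hS0 : ∀ k, 0 ≤ S k := fun k => Finset.sum_nonneg fun i _ => by positivity
  have hSs : ∀ k, S (k + 1) = γ * S k + ‖w k‖ := fun k => sum_pow_mul_succ γ (‖w ·‖) k
  have hstep : ∀ k, p (x (k + 1) - y (k + 1)) ≤ p (f (x k) - f (y k)) + a * ‖w k‖ := by
    intro k
    rw [hx, hy, ← sub_sub]
    exact (hp_sub _ _).trans (add_le_add_right (hp_le _) _)
  have hp0 := hp_nonneg (x 0 - y 0)
  have hstart : ∀ k, p (x k - y k) ≤ q ^ k * (γ ^ k * p (x 0 - y 0) + a * S k) := by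
    intro k
    induction k with
    | zero => simp [hS]
    | succ k ih =>
      have h1 := (hstep k).trans (add_le_add_left (hlip _ (hxD k) _ (hyD k)) _)
      have h2 := mul_le_mul_of_nonneg_left ih (zero_le_one.trans hΛ)
      have h3 : a * ‖w k‖ ≤ q ^ (k + 1) * (a * ‖w k‖) :=
        le_mul_of_one_le_left (by positivity) (one_le_pow₀ hq1)
      calc _ ≤ Λ * (q ^ k * (γ ^ k * p (x 0 - y 0) + a * S k)) + q ^ (k + 1) * (a * ‖w k‖) := by
            linarith
        _ = _ := by rw [hSs, ← hqγ]; ring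
  have hmain : ∀ k, p (x k - y k) ≤ q ^ τ * (γ ^ k * p (x 0 - y 0)) + Cw * S k := by
    intro k
    rcases le_total k τ with hk | hk
    · refine (hstart k).trans ?_
      have h1 : q ^ k ≤ q ^ τ := pow_le_pow_right₀ hq1 hk
      have h2 : 0 ≤ γ ^ k * p (x 0 - y 0) + a * S k := by have := hS0 k; positivity
      have h3 := mul_le_mul_of_nonneg_right h1 h2
      have h4 := mul_nonneg hM (hS0 k)
      rw [hCw]
      linarith
    · induction k, hk using Nat.le_induction with
      | base =>
        refine (hstart τ).trans ?_
        have h4 := mul_nonneg hM (hS0 τ)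
        rw [hCw]
        linarith
      | succ k hk ih =>
        obtain ⟨j, rfl⟩ := Nat.exists_eq_add_of_le' hk
        -- Either the last `τ` disturbances were small, so both trajectories are in `Ω` and the step
        -- contracts, or one was large and the diameter bound suffices.
        by_cases hw : ∀ i < τ, ‖w (j + i)‖ ≤ ε
        · have hyΩ := hattr y w hy hyD j hw
          have hxΩ := hattr x 0 (by simpa using hx) hxD j (by simp [hε.le])
          have h1 := (hstep (j + τ)).trans (add_le_add_left (hcontr _ hxΩ _ hyΩ) _)
          have h2 := mul_le_mul_of_nonneg_left ih hγ.le
          have h3 : a * ‖w (j + τ)‖ ≤ Cw * ‖w (j + τ)‖ :=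
            mul_le_mul_of_nonneg_right (by linarith) (norm_nonneg _)
          rw [hSs]
          calc _ ≤ γ * (q ^ τ * (γ ^ (j + τ) * p (x 0 - y 0)) + Cw * S (j + τ)) +
                Cw * ‖w (j + τ)‖ := by linarith
            _ = _ := by ring
        · push Not at hw
          obtain ⟨i, hi, hwi⟩ := hw
          have h1 : γ ^ (j + τ + 1 - (j + i) - 1) * ‖w (j + i)‖ ≤ S (j + τ + 1) :=
            Finset.single_le_sum (f := fun i => γ ^ (j + τ + 1 - i - 1) * ‖w i‖)
              (fun _ _ => by positivity) (Finset.mem_range.2 (by omega))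
          have h2 : γ ^ τ ≤ γ ^ (j + τ + 1 - (j + i) - 1) :=
            pow_le_pow_of_le_one hγ.le hγ1.le (by omega)
          have h3 : γ ^ τ * ε ≤ S (j + τ + 1) :=
            (mul_le_mul h2 hwi.le hε.le (by positivity)).trans h1
          have h4 : M ≤ Cw * S (j + τ + 1) := by
            have h5 : |M| = |M| / (γ ^ τ * ε) * (γ ^ τ * ε) :=
              (div_mul_cancel₀ _ (by positivity)).symm
            have h6 := mul_le_mul_of_nonneg_left h3 hM
            have h7 := hS0 (j + τ + 1)
            have h8 : 0 ≤ a * q ^ τ * S (j + τ + 1) := by positivity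
            rw [hCw]
            linarith [le_abs_self M]
          have h5 : 0 ≤ q ^ τ * (γ ^ (j + τ + 1) * p (x 0 - y 0)) := by positivity
          exact (hbdd _ (hxD _) _ (hyD _)).trans (by linarith)
  intro k
  have h1 := (hp_ge _).trans (mul_le_mul_of_nonneg_left (hmain k) hb.le)
  have h2 := mul_le_mul_of_nonneg_left (hp_le (x 0 - y 0))
    (show 0 ≤ b * q ^ τ * γ ^ k by positivity)
  calc _ ≤ b * q ^ τ * γ ^ k * (a * ‖x 0 - y 0‖) + b * (Cw * S k) := by linarith
    _ = _ := by ring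

namespace Data

variable {n m N : ℕ} {D : Data n m N}

/-! ### Incremental stability of optimal MPC -/

lemma rN_nonneg (c : ℝ) : 0 ≤ D.rN c := Real.sqrt_nonneg _

lemma IsDecayRate.mapsTo_f {c β : ℝ} (hβ : D.IsDecayRate c β) :
    Set.MapsTo D.f (D.Gam c) (D.Gam c) := fun x hx =>
  (hβ.2.2 x hx).trans ((mul_le_of_le_one_left (psi_nonneg x) hβ.2.1.le).trans hx)

/-- Each step multiplies `ψ` by `β` and adds at most `‖W^{1/2}‖ ε`. The choices of `τ` and `ε` make
the transient `β^τ r_N` and the geometric limit `‖W^{1/2}‖ ε / (1 - β)` at most `√c / 2` each; then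
`‖y‖_P ≤ ψ(y) ≤ √c`. -/
lemma WellPosed.exists_attraction (hD : D.WellPosed) (hN : 1 ≤ N) {c β : ℝ}
    (hc : D.IsLevel c) (hβ : D.IsDecayRate c β) : ∃ ε > 0, ∃ τ : ℕ, ∀ y w : ℕ → Vec (Fin n),
      (∀ k, y (k + 1) = D.f (y k) + w k) → (∀ k, y k ∈ D.Gam c) →
      ∀ k, (∀ i < τ, ‖w (k + i)‖ ≤ ε) → quad D.P (y (k + τ)) ≤ c := by
  obtain ⟨hβ0, hβ1, hdec⟩ := hβ
  have hsc : 0 < √c := Real.sqrt_pos.2 hc.1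
  have hr := D.rN_nonneg c
  set s := ‖CFC.sqrt D.W‖ with hs
  have hs0 : 0 ≤ s := norm_nonneg _
  have hβ' : 0 < 1 - β := by linarith
  obtain ⟨τ, hτ⟩ := exists_pow_lt_of_lt_one (show 0 < √c / (2 * (D.rN c + 1)) by positivity) hβ1
  refine ⟨√c * (1 - β) / (2 * (s + 1)), by positivity, τ, fun y w hy hyD k hw => ?_⟩
  set ε := √c * (1 - β) / (2 * (s + 1)) with hε
  have hε0 : 0 < ε := by positivity
  have key : ∀ i ≤ τ, D.psi (y (k + i)) ≤ β ^ i * D.rN c + s * ε / (1 - β) := by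
    intro i
    induction i with
    | zero =>
      intro _
      have h1 : D.psi (y k) ≤ D.rN c := hyD k
      have h2 : 0 ≤ s * ε / (1 - β) := by positivity
      simpa using h1.trans (le_add_of_nonneg_right h2)
    | succ i ih =>
      intro hi
      have h1 := ih (by omega)
      have h2 := hD.psi_add_le (D.f (y (k + i))) (w (k + i))
      rw [← hy, ← norm_sqrt_act (hD.W_pos hN).posSemidef] at h2
      have h3 := norm_act_le (CFC.sqrt D.W) (w (k + i))
      have h4 := mul_le_mul_of_nonneg_left (hw i (by omega)) hs0
      have h5 := hdec _ (hyD (k + i))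
      have h6 := mul_le_mul_of_nonneg_left h1 hβ0.le
      have h7 : β * (s * ε / (1 - β)) + s * ε = s * ε / (1 - β) := by field_simp; ring
      rw [← add_assoc, pow_succ']
      linarith
  have h1 := key τ le_rfl
  have h2 : β ^ τ * D.rN c ≤ √c / 2 := by
    have h3 := mul_le_mul_of_nonneg_right hτ.le (show 0 ≤ D.rN c + 1 by linarith)
    have h4 : √c / (2 * (D.rN c + 1)) * (D.rN c + 1) = √c / 2 := by field_simp
    have h5 : 0 ≤ β ^ τ := by positivity
    linarith
  have h3 : s * ε / (1 - β) ≤ √c / 2 := by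
    have h4 : s * ε / (1 - β) = s / (s + 1) * (√c / 2) := by rw [hε]; field_simp
    rw [h4]
    exact mul_le_of_le_one_left (by positivity) ((div_le_one (by positivity)).2 (by linarith))
  refine (hD.quad_P_le_psi_sq _).trans ?_
  rw [← Real.sq_sqrt hc.1.le]
  exact pow_le_pow_left₀ (psi_nonneg _) (by linarith) 2

lemma WellPosed.norm_f_sub_le (hD : D.WellPosed) (x y : Vec (Fin n)) :
    ‖D.f x - D.f y‖ ≤ (‖D.A‖ + ‖D.Bbar‖ * D.L) * ‖x - y‖ := by
  have h : D.f x - D.f y = act D.A (x - y) + act D.Bbar (D.muStar x - D.muStar y) := by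
    rw [f, f, act_sub, act_sub]; abel
  have h1 := norm_act_le D.A (x - y)
  have h2 := norm_act_le D.Bbar (D.muStar x - D.muStar y)
  have h3 := mul_le_mul_of_nonneg_left (hD.norm_muStar_sub_le x y) (norm_nonneg D.Bbar)
  rw [h]
  refine (norm_add_le _ _).trans ?_
  linarith

lemma WellPosed.exists_isEDeltaISS (hD : D.WellPosed) (hN : 1 ≤ N) {c β : ℝ} (hc : D.IsLevel c)
    (hβ : D.IsDecayRate c β) {r : ℝ} (hr : 0 < r) :
    ∃ c₀ cw ρ, IsEDeltaISS D.f (D.Gam c) c₀ cw r ρ := by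
  obtain ⟨ε, hε, τ, hattr⟩ := hD.exists_attraction hN hc hβ
  obtain ⟨δ, hδ0, hδ1, hδ⟩ := exists_mul_quad_le_quad hD.Q_pos D.P
  obtain ⟨g, hg, hψ⟩ := hD.exists_norm_le_psi hN
  set T := CFC.sqrt D.P
  set a := ‖T‖ + 1
  set b := ‖invSqrt D.P‖ + 1
  set l := ‖D.A‖ + ‖D.Bbar‖ * D.L
  have ha : 0 < a := by positivity
  have hb : 0 < b := by positivity
  have hl : 0 ≤ l := by have := D.L_nonneg; positivity
  have hp_le : ∀ v, ‖act T v‖ ≤ a * ‖v‖ := fun v =>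
    (norm_act_le T v).trans (mul_le_mul_of_nonneg_right (by simp [a]) (norm_nonneg v))
  have hp_ge : ∀ v, ‖v‖ ≤ b * ‖act T v‖ := fun v =>
    (norm_le_invSqrt hD.P_pos v).trans
      (mul_le_mul_of_nonneg_right (by simp [b]) (norm_nonneg _))
  have hlip : ∀ x ∈ D.Gam c, ∀ y ∈ D.Gam c,
      ‖act T (D.f x - D.f y)‖ ≤ (1 + a * l * b) * ‖act T (x - y)‖ := by
    intro x _ y _
    calc _ ≤ a * ‖D.f x - D.f y‖ := hp_le _
      _ ≤ a * (l * ‖x - y‖) := mul_le_mul_of_nonneg_left (hD.norm_f_sub_le x y) ha.le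
      _ ≤ a * (l * (b * ‖act T (x - y)‖)) := by gcongr; exact hp_ge _
      _ ≤ _ := by linarith [norm_nonneg (act T (x - y))]
  -- On `Ω` the difference of two states evolves under `A - B K`, and `δ P ⪯ Q` makes this a
  -- contraction of the `P`-norm.
  have hcontr : ∀ x ∈ {x | quad D.P x ≤ c}, ∀ y ∈ {x | quad D.P x ≤ c},
      ‖act T (D.f x - D.f y)‖ ≤ √(1 - δ) * ‖act T (x - y)‖ := by
    intro x hx y hy
    have h1 : D.f x - D.f y = act D.A (x - y) + act D.B (-act D.K (x - y)) := by
      rw [hD.f_eq_feedback hN hc hx, hD.f_eq_feedback hN hc hy]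
      simp only [act_sub, act_neg]; abel
    refine abs_le_of_sq_le_sq' ?_ (by positivity) |>.2
    rw [mul_pow, Real.sq_sqrt (by linarith), norm_sqrt_act_sq hD.P_psd,
      norm_sqrt_act_sq hD.P_psd, h1]
    linarith [hD.quad_P_feedback (x - y), hδ (x - y)]
  have hbdd : ∀ x ∈ D.Gam c, ∀ y ∈ D.Gam c,
      ‖act T (x - y)‖ ≤ a * (2 * (g * D.rN c)) := by
    intro x hx y hy
    refine (hp_le _).trans (mul_le_mul_of_nonneg_left ?_ ha.le)
    have h1 := (hψ x).trans (mul_le_mul_of_nonneg_left hx hg.le)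
    have h2 := (hψ y).trans (mul_le_mul_of_nonneg_left hy hg.le)
    linarith [norm_sub_le x y]
  obtain ⟨c₀, cw, h⟩ := LQMPC.exists_isEDeltaISS (f := D.f) (D := D.Gam c)
    (Ω := {x | quad D.P x ≤ c}) (p := fun v => ‖act T v‖) (a := a) (b := b)
    (Λ := 1 + a * l * b) (γ := √(1 - δ)) (M := a * (2 * (g * D.rN c))) (ε := ε) (τ := τ) ha hb
    (le_add_of_nonneg_right (by positivity)) (Real.sqrt_pos.2 (by linarith))
    (by rw [Real.sqrt_lt' one_pos]; linarith) hε (fun v => norm_nonneg _)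
    (fun u v => by simp only [act_sub]; exact norm_sub_le _ _) hp_le hp_ge
    (hβ.mapsTo_f) hlip hcontr hbdd hattr hr
  exact ⟨c₀, cw, _, h⟩

end Data

namespace Data

variable {n m N : ℕ} {D : Data n m N}

/-! ### The combined system-optimizer dynamics -/

/-- The distance of `u_k` to the optimal input at the state `x_k`. -/
def subopt (D : Data n m N) (l : ℕ → ℕ) (x₀ : Vec (Fin n)) (k : ℕ) : ℝ :=
  ‖D.uSub l x₀ k - D.muStar (D.xSub l x₀ k)‖

lemma subopt_nonneg (l : ℕ → ℕ) (x₀ : Vec (Fin n)) (k : ℕ) : 0 ≤ D.subopt l x₀ k :=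
  norm_nonneg _

lemma xSub_succ (l : ℕ → ℕ) (x₀ : Vec (Fin n)) (k : ℕ) :
    D.xSub l x₀ (k + 1) = act D.A (D.xSub l x₀ k) + act D.Bbar (D.uSub l x₀ k) := rfl

lemma xSub_succ_eq_f (l : ℕ → ℕ) (x₀ : Vec (Fin n)) (k : ℕ) :
    D.xSub l x₀ (k + 1) = D.f (D.xSub l x₀ k) +
      act D.Bbar (D.uSub l x₀ k - D.muStar (D.xSub l x₀ k)) := by
  rw [xSub_succ, f, act_sub]; abel

lemma uSub_succ (l : ℕ → ℕ) (x₀ : Vec (Fin n)) (k : ℕ) :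
    D.uSub l x₀ (k + 1) = (D.pgm (D.xSub l x₀ (k + 1)))^[l (k + 1)] (D.uSub l x₀ k) := rfl

lemma WellPosed.subopt_zero_le (hD : D.WellPosed) (l : ℕ → ℕ) (x₀ : Vec (Fin n)) :
    D.subopt l x₀ 0 ≤ D.eta ^ l 0 * ‖0 - D.muStar x₀‖ :=
  hD.norm_iterate_pgm_sub_le x₀ 0 (l 0)

/-- The warm start is off by the old error plus the shift of the optimizer, and the gradient steps
at the new state contract the sum. -/
lemma WellPosed.subopt_succ_le' (hD : D.WellPosed) (l : ℕ → ℕ) (x₀ : Vec (Fin n)) (k : ℕ) :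
    D.subopt l x₀ (k + 1) ≤ D.eta ^ l (k + 1) * (D.subopt l x₀ k +
      ‖D.muStar (D.xSub l x₀ (k + 1)) - D.muStar (D.xSub l x₀ k)‖) := by
  rw [subopt, uSub_succ]
  refine (hD.norm_iterate_pgm_sub_le _ _ _).trans
    (mul_le_mul_of_nonneg_left ?_ (pow_nonneg hD.eta_nonneg _))
  rw [subopt, norm_sub_rev (D.muStar (D.xSub l x₀ (k + 1)))]
  exact norm_sub_le_norm_sub_add_norm_sub _ _ _

lemma WellPosed.subopt_succ_le (hD : D.WellPosed) (l : ℕ → ℕ) (x₀ : Vec (Fin n)) (k : ℕ) :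
    D.subopt l x₀ (k + 1) ≤ D.eta ^ l (k + 1) * (D.subopt l x₀ k +
      D.L * ‖D.xSub l x₀ (k + 1) - D.xSub l x₀ k‖) :=
  (hD.subopt_succ_le' l x₀ k).trans (mul_le_mul_of_nonneg_left
    (add_le_add_right (hD.norm_muStar_sub_le _ _) _) (pow_nonneg hD.eta_nonneg _))

lemma WellPosed.norm_Bbar_muStar_le (hD : D.WellPosed) (hN : 1 ≤ N) (x : Vec (Fin n)) :
    ‖act (invSqrt D.H * D.G * D.Bbar) (D.muStar x)‖ ≤
      √(lamMaxRel D.H ((D.G * D.Bbar)ᵀ * D.H⁻¹ * (D.G * D.Bbar)) * (lamMaxRel D.P D.W - 1)) *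
        D.psi x := by
  set Z := (D.G * D.Bbar)ᵀ * D.H⁻¹ * (D.G * D.Bbar) with hZdef
  have hZ : Z.PosSemidef := by
    have := hD.H_pos.inv.posSemidef.conjTranspose_mul_mul_same (D.G * D.Bbar)
    rwa [Matrix.conjTranspose_eq_transpose_of_trivial] at this
  have h1 : ‖act (invSqrt D.H * D.G * D.Bbar) (D.muStar x)‖ ^ 2 = quad Z (D.muStar x) := by
    rw [hZdef, quad_congr, quad_eq_inner, ← invSqrt_mul_invSqrt hD.H_pos,
      mul_act (invSqrt D.H) (invSqrt D.H), inner_act_symm (invSqrt_isHermitian D.H), ← mul_act,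
      ← Matrix.mul_assoc, real_inner_self_eq_norm_sq]
  have h2 := quad_le_lamMaxRel hD.H_pos hZ.isHermitian (D.muStar x)
  have h3 := lamMaxRel_nonneg (M := D.H) hZ
  have h4 := hD.quad_muStar_le x
  have h5 : quad D.W x ≤ lamMaxRel D.P D.W * D.psi x ^ 2 :=
    (quad_le_lamMaxRel hD.P_pos hD.W_isHermitian x).trans
      (mul_le_mul_of_nonneg_left (hD.quad_P_le_psi_sq x)
        (lamMaxRel_nonneg (hD.W_pos hN).posSemidef))
  have h6 : quad Z (D.muStar x) ≤
      lamMaxRel D.H Z * (lamMaxRel D.P D.W - 1) * D.psi x ^ 2 := by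
    refine h2.trans ?_
    rw [mul_assoc]
    exact mul_le_mul_of_nonneg_left (by linarith) h3
  rw [← Real.sqrt_sq (norm_nonneg (act _ (D.muStar x))), h1]
  refine (Real.sqrt_le_sqrt h6).trans (le_of_eq ?_)
  rw [Real.sqrt_mul' _ (sq_nonneg _), Real.sqrt_sq (psi_nonneg x)]

lemma WellPosed.norm_sqrt_P_act_le (hD : D.WellPosed) (x : Vec (Fin n)) :
    ‖act (CFC.sqrt D.P) x‖ ≤ D.psi x :=
  abs_le_of_sq_le_sq' (by rw [norm_sqrt_act_sq hD.P_psd]; exact hD.quad_P_le_psi_sq x)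
    (psi_nonneg x) |>.2

lemma kappa_nonneg : 0 ≤ D.kappa := by unfold kappa; positivity

lemma sigma_nonneg : 0 ≤ D.sigma := norm_nonneg _

lemma one_le_omega : 1 ≤ D.omega := le_add_of_nonneg_right (by positivity)

/-- The state increment splits into `(A - 1) x`, `B̄ μ⋆(x)` and `B̄ (u - μ⋆(x))`. The first two give
the summands of `κ`, through `‖x‖_P ≤ ψ(x)` and `norm_Bbar_muStar_le`; the third gives `ω - 1`. -/
lemma WellPosed.norm_muStar_xSub_sub_le (hD : D.WellPosed) (hN : 1 ≤ N) (l : ℕ → ℕ)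
    (x₀ : Vec (Fin n)) (k : ℕ) : ‖D.muStar (D.xSub l x₀ (k + 1)) - D.muStar (D.xSub l x₀ k)‖ ≤
      (D.omega - 1) * D.subopt l x₀ k + D.kappa * D.psi (D.xSub l x₀ k) := by
  refine (hD.norm_muStar_sub_le' _ _).trans ?_
  set x := D.xSub l x₀ k with hx
  set d := D.uSub l x₀ k - D.muStar x with hd
  have h1 : act (invSqrt D.H * D.G) (D.xSub l x₀ (k + 1) - x) =
      act (invSqrt D.H * D.G * (D.A - 1) * invSqrt D.P) (act (CFC.sqrt D.P) x) +
      act (invSqrt D.H * D.G * D.Bbar) (D.muStar x) + act (invSqrt D.H * D.G * D.Bbar) d := by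
    rw [mul_act _ (invSqrt D.P), invSqrt_act_sqrt_act hD.P_pos, mul_act _ (D.A - 1),
      mul_act _ D.Bbar, mul_act _ D.Bbar, ← act_add, ← act_add, xSub_succ_eq_f, ← hx, ← hd, f,
      sub_act, one_act]
    congr 1
    abel
  rw [h1]
  have h2 := norm_add₃_le (a := act (invSqrt D.H * D.G * (D.A - 1) * invSqrt D.P)
    (act (CFC.sqrt D.P) x)) (b := act (invSqrt D.H * D.G * D.Bbar) (D.muStar x))
    (c := act (invSqrt D.H * D.G * D.Bbar) d)
  have h3 := (norm_act_le (invSqrt D.H * D.G * (D.A - 1) * invSqrt D.P)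
    (act (CFC.sqrt D.P) x)).trans
    (mul_le_mul_of_nonneg_left (hD.norm_sqrt_P_act_le x) (norm_nonneg _))
  have h4 := hD.norm_Bbar_muStar_le hN x
  have h5 := norm_act_le (invSqrt D.H * D.G * D.Bbar) d
  refine (mul_le_mul_of_nonneg_left (h2.trans (add_le_add (add_le_add h3 h4) h5))
    (norm_nonneg _)).trans (le_of_eq ?_)
  have h6 : D.subopt l x₀ k = ‖d‖ := rfl
  rw [h6, omega, kappa]
  ring

lemma WellPosed.subopt_succ_le_psi (hD : D.WellPosed) (hN : 1 ≤ N) (l : ℕ → ℕ) (x₀ : Vec (Fin n))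
    (k : ℕ) :
    D.subopt l x₀ (k + 1) ≤ D.eta ^ l (k + 1) *
      (D.omega * D.subopt l x₀ k + D.kappa * D.psi (D.xSub l x₀ k)) :=
  (hD.subopt_succ_le' l x₀ k).trans (mul_le_mul_of_nonneg_left
    (by linarith [hD.norm_muStar_xSub_sub_le hN l x₀ k]) (pow_nonneg hD.eta_nonneg _))

lemma WellPosed.psi_xSub_succ_le (hD : D.WellPosed) (hN : 1 ≤ N) {c β : ℝ}
    (hβ : D.IsDecayRate c β) (l : ℕ → ℕ) (x₀ : Vec (Fin n)) (k : ℕ)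
    (hk : D.xSub l x₀ k ∈ D.Gam c) :
    D.psi (D.xSub l x₀ (k + 1)) ≤
      β * D.psi (D.xSub l x₀ k) + D.sigma * D.subopt l x₀ k := by
  rw [xSub_succ_eq_f]
  refine (hD.psi_add_le _ _).trans (add_le_add (hβ.2.2 _ hk) ?_)
  rw [← norm_sqrt_act (hD.W_pos hN).posSemidef, ← mul_act]
  exact norm_act_le _ _

/-! ### The iteration threshold and forward invariance -/

/-- Restates `ℓ > ℓ⋆` as a bound on `η^ℓ`. As `ℓ` is an integer, it is at least `⌊ℓ⋆⌋ + 1`, so one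
`q` with a strict margin serves all admissible iteration numbers; this makes the later constants
uniform. For `η = 0` only `ℓ ≥ 1` matters. -/
lemma WellPosed.exists_contraction_bound (hD : D.WellPosed) {c β : ℝ}
    (hβ : D.IsDecayRate c β) :
    ∃ q, 0 ≤ q ∧ q * (D.sigma * D.kappa + D.omega * (1 - β)) < 1 - β ∧
      ∀ l : ℕ, D.lStar β < l → 1 ≤ l ∧ D.eta ^ l ≤ q := by
  have hβ1 : 0 < 1 - β := by linarith [hβ.2.1]
  have hη0 := hD.eta_nonneg
  have hη1 := hD.eta_lt_one
  set s := D.sigma * D.kappa + D.omega * (1 - β) with hs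
  have hs1 : 1 - β ≤ s := by
    have h1 := mul_nonneg D.sigma_nonneg D.kappa_nonneg
    have h2 := mul_le_mul_of_nonneg_right D.one_le_omega hβ1.le
    linarith
  have hs0 : 0 < s := hβ1.trans_le hs1
  have hl0 : 0 ≤ D.lStar β := div_nonneg_of_nonpos
    (sub_nonpos.2 (Real.log_le_log hβ1 hs1)) (Real.log_nonpos hη0 hη1.le)
  have hl1 : ∀ l : ℕ, D.lStar β < l → 1 ≤ l := fun l hl => by
    exact_mod_cast hl0.trans_lt hl
  rcases hη0.eq_or_lt with h0 | h0
  · refine ⟨0, le_rfl, by simpa using hβ1, fun l hl => ⟨hl1 l hl, ?_⟩⟩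
    rw [← h0, zero_pow (by have := hl1 l hl; omega)]
  · refine ⟨D.eta ^ (⌊D.lStar β⌋₊ + 1), by positivity, ?_, fun l hl => ⟨hl1 l hl, ?_⟩⟩
    · have h1 : D.lStar β < ((⌊D.lStar β⌋₊ + 1 : ℕ) : ℝ) := by
        push_cast; exact Nat.lt_floor_add_one _
      set l := ⌊D.lStar β⌋₊ + 1
      -- `log η < 0`, so clearing the denominator reverses the inequality.
      rw [lStar, ← hs, div_lt_iff_of_neg (Real.log_neg h0 hη1), ← Real.log_pow] at h1
      rw [← lt_div_iff₀ hs0]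
      refine (Real.log_lt_log_iff (by positivity) (by positivity)).1 ?_
      rwa [Real.log_div hβ1.ne' hs0.ne']
    · exact pow_le_pow_of_le_one hη0 hη1.le ((Nat.floor_lt hl0).2 hl)

/-- `W^{1/2}` is invertible, so `σ = 0` forces `B̄ = 0`. Since `N ≥ 1`, `B̄` contains `B` as a
block; hence `B = 0` and `G = 0`. -/
lemma WellPosed.L_eq_zero_of_sigma (hD : D.WellPosed) (hN : 1 ≤ N) (h : D.sigma = 0) :
    D.L = 0 := by
  have h1 : D.Bbar = 0 := by
    have h2 : CFC.sqrt D.W * D.Bbar = 0 := norm_eq_zero.1 h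
    have h3 := congrArg (invSqrt D.W * ·) h2
    simpa [← Matrix.mul_assoc, invSqrt_mul_sqrt (hD.W_pos hN)] using h3
  have h2 : D.B = 0 := by
    ext a b
    have h3 := congrFun (congrFun h1 a) (⟨0, hN⟩, b)
    simpa [Bbar, S, Matrix.mul_apply] using h3
  have h3 : ∀ i, D.predict i = 0 := by
    intro i
    ext a jb
    simp [predict, h2]
  have h4 : D.G = 0 := by simp [G, h3]
  simp [L, h4]

/-- The radius `(1 - β) r_N / σ` balances the recursion for `ψ`, since `β r_N + σ · (1 - β) r_N / σ
= r_N`. The new error is at most `q (ω (1 - β) r_N / σ + κ r_N)`, and the condition on `q` keeps it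
within the same radius. -/
lemma WellPosed.mem_Sig_succ (hD : D.WellPosed) (hN : 1 ≤ N) {c β : ℝ}
    (hβ : D.IsDecayRate c β) {l : ℕ → ℕ} (hl : ∀ k, D.lStar β < l k) (x₀ : Vec (Fin n)) (k : ℕ)
    (h : (D.xSub l x₀ k, D.uSub l x₀ k) ∈ D.Sig c β) :
    (D.xSub l x₀ (k + 1), D.uSub l x₀ (k + 1)) ∈ D.Sig c β := by
  obtain ⟨hx, hu, hd⟩ := h
  replace hd : D.subopt l x₀ k ≤ (1 - β) * D.rN c / D.sigma := hd
  replace hx : D.psi (D.xSub l x₀ k) ≤ D.rN c := hx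
  have hβ1 : 0 < 1 - β := by linarith [hβ.2.1]
  have hr := D.rN_nonneg c
  obtain ⟨q, hq0, hq, hql⟩ := hD.exists_contraction_bound hβ
  have h1 := hD.psi_xSub_succ_le hN hβ l x₀ k hx
  have h2 := mul_le_mul_of_nonneg_left hx hβ.1.le
  refine ⟨?_, hD.iterate_pgm_mem _ hu _, ?_⟩
  · change D.psi (D.xSub l x₀ (k + 1)) ≤ D.rN c
    rcases D.sigma_nonneg.eq_or_lt with h0 | h0
    · rw [← h0] at h1; linarith [mul_le_mul_of_nonneg_right hβ.2.1.le hr]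
    · rw [le_div_iff₀ h0] at hd; linarith
  · change D.subopt l x₀ (k + 1) ≤ _
    rcases D.sigma_nonneg.eq_or_lt with h0 | h0
    · have h3 := hD.subopt_succ_le l x₀ k
      rw [hD.L_eq_zero_of_sigma hN h0.symm, zero_mul, add_zero] at h3
      -- Division by zero gives `0`, so membership in `Σ_N` says that the error vanishes; it stays
      -- zero because `L = 0`.
      rw [← h0, div_zero] at hd ⊢
      exact h3.trans (mul_nonpos_of_nonneg_of_nonpos (pow_nonneg hD.eta_nonneg _) hd)
    · refine (hD.subopt_succ_le_psi hN l x₀ k).trans ?_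
      have hω := zero_le_one.trans D.one_le_omega
      have h3 : D.omega * D.subopt l x₀ k + D.kappa * D.psi (D.xSub l x₀ k) ≤
          D.omega * ((1 - β) * D.rN c / D.sigma) + D.kappa * D.rN c :=
        add_le_add (mul_le_mul_of_nonneg_left hd hω) (mul_le_mul_of_nonneg_left hx D.kappa_nonneg)
      have h4 : 0 ≤ D.omega * ((1 - β) * D.rN c / D.sigma) + D.kappa * D.rN c := by
        have := D.kappa_nonneg; positivity
      refine (mul_le_mul (hql _ (hl (k + 1))).2 h3 ?_ hq0).trans ?_
      · exact add_nonneg (mul_nonneg hω (subopt_nonneg _ _ _))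
          (mul_nonneg D.kappa_nonneg (psi_nonneg _))
      · rw [le_div_iff₀ h0]
        have h5 := mul_le_mul_of_nonneg_right hq.le hr
        refine le_trans (le_of_eq ?_) h5
        field_simp
        ring

lemma WellPosed.mem_Sig (hD : D.WellPosed) (hN : 1 ≤ N) {c β : ℝ}
    (hβ : D.IsDecayRate c β) {l : ℕ → ℕ} (hl : ∀ k, D.lStar β < l k) {x₀ : Vec (Fin n)}
    (h : (x₀, D.uSub l x₀ 0) ∈ D.Sig c β) (k : ℕ) :
    (D.xSub l x₀ k, D.uSub l x₀ k) ∈ D.Sig c β := by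
  induction k with
  | zero => exact h
  | succ k ih => exact hD.mem_Sig_succ hN hβ hl x₀ k ih

lemma WellPosed.muStar_mem_Sig (hD : D.WellPosed) {c β : ℝ} (hβ : D.IsDecayRate c β)
    {x : Vec (Fin n)} (hx : x ∈ D.Gam c) : (x, D.muStar x) ∈ D.Sig c β := by
  refine ⟨hx, (hD.muStar_spec x).1, ?_⟩
  have hβ1 : 0 < 1 - β := by linarith [hβ.2.1]
  have hr := D.rN_nonneg c
  have hs := D.sigma_nonneg
  simp only [sub_self, norm_zero]
  positivity

/-! ### The path length of the suboptimal trajectory -/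

/-- With `X` and `Y` the partial sums, summation gives `(1 - β) X ≤ ψ 0 + σ Y` and `(1 - a) Y ≤ d 0
+ b X`. Eliminating `Y` leaves the determinant of this system as denominator, positive by small
gain. -/
lemma sum_le_of_coupled_recursion {ψ d : ℕ → ℝ} {β σ a b : ℝ} (hψ : ∀ k, 0 ≤ ψ k)
    (hd : ∀ k, 0 ≤ d k) (hσ : 0 ≤ σ) (hβ : β < 1) (ha : 0 ≤ a)
    (h : σ * b < (1 - β) * (1 - a)) (hb : 0 ≤ b)
    (h1 : ∀ k, ψ (k + 1) ≤ β * ψ k + σ * d k) (h2 : ∀ k, d (k + 1) ≤ a * d k + b * ψ k) (T : ℕ) :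
    ∑ k ∈ Finset.range T, ψ k ≤ (ψ 0 + σ * d 0) / ((1 - β) * (1 - a) - σ * b) := by
  set X := ∑ k ∈ Finset.range T, ψ k with hX
  set Y := ∑ k ∈ Finset.range T, d k with hY
  have hX1 : X ≤ ψ 0 + (β * X + σ * Y) := by
    have h3 : X ≤ ∑ k ∈ Finset.range (T + 1), ψ k := by
      rw [Finset.sum_range_succ]; linarith [hψ T]
    rw [Finset.sum_range_succ', add_comm] at h3
    refine h3.trans (add_le_add_right ?_ _)
    rw [hX, hY, Finset.mul_sum, Finset.mul_sum, ← Finset.sum_add_distrib]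
    exact Finset.sum_le_sum fun k _ => h1 k
  have hY1 : Y ≤ d 0 + (a * Y + b * X) := by
    have h3 : Y ≤ ∑ k ∈ Finset.range (T + 1), d k := by
      rw [Finset.sum_range_succ]; linarith [hd T]
    rw [Finset.sum_range_succ', add_comm] at h3
    refine h3.trans (add_le_add_right ?_ _)
    rw [hX, hY, Finset.mul_sum, Finset.mul_sum, ← Finset.sum_add_distrib]
    exact Finset.sum_le_sum fun k _ => h2 k
  have ha1 : 0 < 1 - a := by
    by_contra! h3
    have := mul_nonneg hσ hb
    nlinarith
  rw [le_div_iff₀ (by linarith)]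
  have h3 := mul_le_mul_of_nonneg_left hX1 ha1.le
  have h4 := mul_le_mul_of_nonneg_left hY1 hσ
  have h5 : (1 - a) * ψ 0 ≤ ψ 0 := mul_le_of_le_one_left (hψ 0) (by linarith)
  linarith

/-- The path length is at most twice the sum of the state norms, and these are controlled by `ψ`.
The determinant `μ` of the coupled recursion is positive by the defining inequality of `q`. -/
lemma WellPosed.exists_sum_norm_xSub_sub_le (hD : D.WellPosed) (hN : 1 ≤ N) {c β : ℝ}
    (hβ : D.IsDecayRate c β) :
    ∃ C, 0 ≤ C ∧ ∀ l : ℕ → ℕ, (∀ k, D.lStar β < l k) →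
      ∀ x₀, (x₀, D.uSub l x₀ 0) ∈ D.Sig c β → ∀ T,
        ∑ k ∈ Finset.Ico 1 T, ‖D.xSub l x₀ k - D.xSub l x₀ (k - 1)‖ ≤ C * ‖x₀‖ := by
  obtain ⟨q, hq0, hq, hql⟩ := hD.exists_contraction_bound hβ
  obtain ⟨b, hb, hbψ⟩ := hD.exists_norm_le_psi hN
  set μ := (1 - β) * (1 - q * D.omega) - D.sigma * (q * D.kappa) with hμ
  have hμ0 : 0 < μ := by rw [hμ]; linarith
  set s := ‖CFC.sqrt D.W‖
  have hσ := D.sigma_nonneg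
  have hL := D.L_nonneg
  have hω := zero_le_one.trans D.one_le_omega
  refine ⟨2 * b * ((s + D.sigma * D.L) / μ), by positivity, fun l hl x₀ hx₀ T => ?_⟩
  have hS := hD.mem_Sig hN hβ hl hx₀
  have h1 := sum_le_of_coupled_recursion (ψ := fun k => D.psi (D.xSub l x₀ k))
    (d := D.subopt l x₀) (a := q * D.omega) (b := q * D.kappa) (fun k => psi_nonneg _)
    (fun k => subopt_nonneg _ _ _) hσ hβ.2.1 (mul_nonneg hq0 hω) (by linarith)
    (mul_nonneg hq0 D.kappa_nonneg) (fun k => hD.psi_xSub_succ_le hN hβ l x₀ k (hS k).1)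
    (fun k => by
      refine (hD.subopt_succ_le_psi hN l x₀ k).trans ?_
      have h2 : 0 ≤ D.omega * D.subopt l x₀ k + D.kappa * D.psi (D.xSub l x₀ k) :=
        add_nonneg (mul_nonneg hω (subopt_nonneg _ _ _))
          (mul_nonneg D.kappa_nonneg (psi_nonneg _))
      linarith [mul_le_mul_of_nonneg_right (hql _ (hl (k + 1))).2 h2]) T
  rw [← hμ] at h1
  have h2 : D.psi (D.xSub l x₀ 0) ≤ s * ‖x₀‖ := by
    refine (hD.psi_le_sqrt_quad x₀).trans ?_
    rw [← norm_sqrt_act (hD.W_pos hN).posSemidef]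
    exact norm_act_le _ _
  have h3 : D.subopt l x₀ 0 ≤ D.L * ‖x₀‖ := by
    refine (hD.subopt_zero_le l x₀).trans ?_
    rw [zero_sub, norm_neg]
    exact (mul_le_of_le_one_left (norm_nonneg _)
      (pow_le_one₀ hD.eta_nonneg hD.eta_lt_one.le)).trans (hD.norm_muStar_le x₀)
  have h4 : ∑ k ∈ Finset.range T, D.psi (D.xSub l x₀ k) ≤ (s + D.sigma * D.L) / μ * ‖x₀‖ := by
    refine h1.trans ?_
    rw [div_mul_eq_mul_div]
    refine div_le_div_of_nonneg_right ?_ hμ0.le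
    linarith [mul_le_mul_of_nonneg_left h3 hσ]
  have h5 : ∑ k ∈ Finset.Ico 1 T, ‖D.xSub l x₀ k‖ ≤
      ∑ k ∈ Finset.range T, ‖D.xSub l x₀ k‖ := by
    refine Finset.sum_le_sum_of_subset_of_nonneg (fun k hk => ?_) fun _ _ _ => norm_nonneg _
    exact Finset.mem_range.2 (Finset.mem_Ico.1 hk).2
  have h6 : ∑ k ∈ Finset.Ico 1 T, ‖D.xSub l x₀ (k - 1)‖ ≤
      ∑ k ∈ Finset.range T, ‖D.xSub l x₀ k‖ := by
    rw [Finset.sum_Ico_eq_sum_range]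
    simp only [add_tsub_cancel_left]
    exact Finset.sum_le_sum_of_subset_of_nonneg (Finset.range_mono (Nat.sub_le T 1))
      fun _ _ _ => norm_nonneg _
  have h7 : ∑ k ∈ Finset.range T, ‖D.xSub l x₀ k‖ ≤
      b * ∑ k ∈ Finset.range T, D.psi (D.xSub l x₀ k) := by
    rw [Finset.mul_sum]
    exact Finset.sum_le_sum fun k _ => hbψ _
  have h8 : ∑ k ∈ Finset.Ico 1 T, ‖D.xSub l x₀ k - D.xSub l x₀ (k - 1)‖ ≤
      ∑ k ∈ Finset.Ico 1 T, ‖D.xSub l x₀ k‖ + ∑ k ∈ Finset.Ico 1 T, ‖D.xSub l x₀ (k - 1)‖ := by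
    rw [← Finset.sum_add_distrib]
    exact Finset.sum_le_sum fun k _ => norm_sub_le _ _
  have h9 := mul_le_mul_of_nonneg_left h4 hb.le
  linarith

end Data

namespace Data

variable {n m N : ℕ} {D : Data n m N}

/-! ### Existence of the constants -/

lemma WellPosed.exists_isCostLipschitz (hD : D.WellPosed) (hN : 1 ≤ N) (c β : ℝ) :
    ∃ Mx Mu, D.IsCostLipschitz (D.Sig c β) Mx Mu := by
  obtain ⟨b, hb, hbψ⟩ := hD.exists_norm_le_psi hN
  set bx := b * D.rN c
  set bz := D.L * bx + |(1 - β) * D.rN c / D.sigma|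
  have hbx : 0 ≤ bx := mul_nonneg hb.le (rN_nonneg c)
  have hL := D.L_nonneg
  have hbz : 0 ≤ bz := by positivity
  have hx : ∀ p ∈ D.Sig c β, ‖p.1‖ ≤ bx := fun p hp =>
    (hbψ p.1).trans (mul_le_mul_of_nonneg_left hp.1 hb.le)
  have hz : ∀ p ∈ D.Sig c β, ‖p.2‖ ≤ bz := fun p hp => by
    have h1 := hD.norm_muStar_le p.1
    have h2 := mul_le_mul_of_nonneg_left (hx p hp) hL
    have h3 := hp.2.2.trans (le_abs_self _)
    have h4 := norm_le_norm_add_norm_sub' p.2 (D.muStar p.1)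
    linarith
  have key : ∀ {ι : Type} [Fintype ι] [DecidableEq ι] (M : Matrix ι ι ℝ) (u v : Vec ι) (r : ℝ),
      ‖u‖ ≤ r → ‖v‖ ≤ r → |quad M u - quad M v| ≤ ‖M‖ * (2 * r) * ‖u - v‖ := by
    intro ι _ _ M u v r hu hv
    refine (abs_quad_sub_le M u v).trans ?_
    gcongr
    linarith
  set Rb := (S m N)ᵀ * D.R * S m N
  refine ⟨(‖D.Q‖ + ‖D.P‖) * (2 * bx) + 1, ‖Rb‖ * (2 * bz) + 1, by positivity, by positivity,
    fun p hp q hq => ⟨?_, ?_⟩⟩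
  · have h1 := key D.Q p.1 q.1 bx (hx p hp) (hx q hq)
    have h2 := key Rb p.2 q.2 bz (hz p hp) (hz q hq)
    have h3 : D.stageCost p.1 p.2 - D.stageCost q.1 q.2 =
        (quad D.Q p.1 - quad D.Q q.1) + (quad Rb p.2 - quad Rb q.2) := by
      simp only [stageCost, Rb]; ring
    rw [h3]
    refine (abs_add_le _ _).trans ?_
    have h4 : 0 ≤ ‖D.P‖ * (2 * bx) * ‖p.1 - q.1‖ := by positivity
    linarith [norm_nonneg (p.1 - q.1), norm_nonneg (p.2 - q.2)]
  · have h1 := key D.P p.1 q.1 bx (hx p hp) (hx q hq)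
    have h4 : 0 ≤ ‖D.Q‖ * (2 * bx) * ‖p.1 - q.1‖ := by positivity
    linarith [norm_nonneg (p.1 - q.1)]

lemma WellPosed.exists_admissible (hD : D.WellPosed) (hN : 1 ≤ N) {c β : ℝ} (hc : D.IsLevel c)
    (hβ : D.IsDecayRate c β) :
    ∃ c₀ cw rw ρ Mx Mu, IsEDeltaISS D.f (D.Gam c) c₀ cw rw ρ ∧
      (∀ p ∈ D.Sig c β, ‖act D.Bbar (p.2 - D.muStar p.1)‖ ≤ rw) ∧
      D.IsCostLipschitz (D.Sig c β) Mx Mu := by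
  obtain ⟨Mx, Mu, hM⟩ := hD.exists_isCostLipschitz hN c β
  -- Stability holds for every disturbance bound, so the bound can be taken large enough for all
  -- errors occurring on `Σ_N`; the `1` keeps it positive.
  set r := ‖D.Bbar‖ * |(1 - β) * D.rN c / D.sigma| + 1
  obtain ⟨c₀, cw, ρ, h⟩ := hD.exists_isEDeltaISS hN hc hβ (r := r) (by positivity)
  refine ⟨c₀, cw, r, ρ, Mx, Mu, h, fun p hp => ?_, hM⟩
  have h1 := mul_le_mul_of_nonneg_left (hp.2.2.trans (le_abs_self _)) (norm_nonneg D.Bbar)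
  linarith [norm_act_le D.Bbar (p.2 - D.muStar p.1)]

/-! ### The suboptimality gap -/

lemma state_uSub (l : ℕ → ℕ) (x₀ : Vec (Fin n)) (k : ℕ) :
    D.state x₀ (fun k => act (S m N) (D.uSub l x₀ k)) k = D.xSub l x₀ k := by
  induction k with
  | zero => rfl
  | succ k ih => rw [state, ih, xSub_succ, Bbar, mul_act]

lemma xStar_succ (x₀ : Vec (Fin n)) (k : ℕ) : D.xStar x₀ (k + 1) = D.f (D.xStar x₀ k) :=
  Function.iterate_succ_apply' _ _ _

lemma state_xStar (x₀ : Vec (Fin n)) (k : ℕ) :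
    D.state x₀ (fun k => act (S m N) (D.muStar (D.xStar x₀ k))) k = D.xStar x₀ k := by
  induction k with
  | zero => rfl
  | succ k ih => rw [state, ih, xStar_succ, f, Bbar, mul_act]

lemma gap_eq (l : ℕ → ℕ) (T : ℕ) (x₀ : Vec (Fin n)) :
    D.gap l T x₀ = (quad D.P (D.xSub l x₀ T) - quad D.P (D.xStar x₀ T)) +
      ∑ k ∈ Finset.range T, (D.stageCost (D.xSub l x₀ k) (D.uSub l x₀ k) -
        D.stageCost (D.xStar x₀ k) (D.muStar (D.xStar x₀ k))) := by
  simp only [gap, cost, state_uSub, state_xStar, stageCost, quad_congr, Finset.sum_sub_distrib]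
  ring

/-- The inner sums satisfy `S (k + 1) = ρ * S k + w k`; summing this recursion avoids interchanging
the double sum. -/
lemma sum_sum_pow_mul_le {ρ : ℝ} (hρ : 0 < ρ) (hρ1 : ρ < 1) {w : ℕ → ℝ} (hw : ∀ i, 0 ≤ w i)
    (T : ℕ) :
    ∑ k ∈ Finset.range (T + 1), ∑ i ∈ Finset.range k, ρ ^ (k - i - 1) * w i ≤
      (∑ i ∈ Finset.range T, w i) / (1 - ρ) := by
  set S : ℕ → ℝ := fun k => ∑ i ∈ Finset.range k, ρ ^ (k - i - 1) * w i
  have hS : ∀ k, 0 ≤ S k := fun k => Finset.sum_nonneg fun i _ =>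
    mul_nonneg (pow_nonneg hρ.le _) (hw i)
  change ∑ k ∈ Finset.range (T + 1), S k ≤ _
  have h1 : ∑ k ∈ Finset.range (T + 1), S k =
      ρ * ∑ k ∈ Finset.range T, S k + ∑ i ∈ Finset.range T, w i := by
    rw [Finset.sum_range_succ', Finset.mul_sum, ← Finset.sum_add_distrib]
    simp only [S, Finset.range_zero, Finset.sum_empty, add_zero]
    exact Finset.sum_congr rfl fun k _ => sum_pow_mul_succ ρ w k
  have h2 : ∑ k ∈ Finset.range T, S k ≤ ∑ k ∈ Finset.range (T + 1), S k := by
    rw [Finset.sum_range_succ]; linarith [hS T]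
  rw [le_div_iff₀ (by linarith)]
  linarith [mul_le_mul_of_nonneg_left h2 hρ.le]

lemma Mbar_nonneg {cw ρ Mx Mu : ℝ} (hcw : 0 < cw) (hρ : ρ < 1) (hMx : 0 < Mx) (hMu : 0 < Mu) :
    0 ≤ D.Mbar cw ρ Mx Mu := by
  have h1 := D.L_nonneg
  have h2 : 0 < 1 - ρ := by linarith
  unfold Mbar
  positivity

/-- Both loops start at `x₀`, so incremental stability bounds their distance by the convolution of
the errors alone. Stage costs are compared at pairs of `Σ_N`, using `‖u - μ⋆(x⋆)‖ ≤ d + L ‖x - x⋆‖`.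
-/
lemma WellPosed.abs_gap_le_sum (hD : D.WellPosed) (hN : 1 ≤ N) {c β c₀ cw rw ρ Mx Mu : ℝ}
    (hβ : D.IsDecayRate c β) (hiss : IsEDeltaISS D.f (D.Gam c) c₀ cw rw ρ)
    (hrw : ∀ p ∈ D.Sig c β, ‖act D.Bbar (p.2 - D.muStar p.1)‖ ≤ rw)
    (hM : D.IsCostLipschitz (D.Sig c β) Mx Mu) {l : ℕ → ℕ} (hl : ∀ k, D.lStar β < l k)
    {x₀ : Vec (Fin n)} (hx₀ : (x₀, D.uSub l x₀ 0) ∈ D.Sig c β) (T : ℕ) :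
    |D.gap l T x₀| ≤ D.Mbar cw ρ Mx Mu * ∑ k ∈ Finset.range T, D.subopt l x₀ k := by
  obtain ⟨hMx, hMu, hLip⟩ := hM
  have hS := hD.mem_Sig hN hβ hl hx₀
  have hstar : ∀ k, D.xStar x₀ k ∈ D.Gam c := by
    intro k
    induction k with
    | zero => exact hx₀.1
    | succ k ih => rw [xStar_succ]; exact hiss.invariant ih
  set d := D.subopt l x₀
  set e : ℕ → ℝ := fun k => ‖D.xSub l x₀ k - D.xStar x₀ k‖ with he
  have he0 : ∀ k, 0 ≤ e k := fun k => norm_nonneg _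
  have hL := D.L_nonneg
  have herr : ∀ k, e k ≤ cw * ‖D.Bbar‖ * ∑ i ∈ Finset.range k, ρ ^ (k - i - 1) * d i := by
    intro k
    have h1 := hiss.bound (D.xStar x₀) (D.xSub l x₀)
      (fun k => act D.Bbar (D.uSub l x₀ k - D.muStar (D.xSub l x₀ k)))
      (fun k => xStar_succ x₀ k) (fun k => xSub_succ_eq_f l x₀ k) hx₀.1 (fun k => (hS k).1)
      (fun k => hrw _ (hS k)) k
    have h2 : D.xStar x₀ 0 - D.xSub l x₀ 0 = 0 := sub_self x₀
    rw [h2, norm_zero, mul_zero, zero_add] at h1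
    simp only [he]
    rw [norm_sub_rev, mul_assoc, Finset.mul_sum]
    refine h1.trans (mul_le_mul_of_nonneg_left (Finset.sum_le_sum fun i _ => ?_) hiss.cw_pos.le)
    rw [mul_left_comm]
    exact mul_le_mul_of_nonneg_left (norm_act_le _ _) (pow_nonneg hiss.ρ_pos.le _)
  have hsum : ∑ k ∈ Finset.range (T + 1), e k ≤
      cw * ‖D.Bbar‖ * ((∑ k ∈ Finset.range T, d k) / (1 - ρ)) := by
    refine (Finset.sum_le_sum fun k _ => herr k).trans ?_
    rw [← Finset.mul_sum]
    exact mul_le_mul_of_nonneg_left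
      (sum_sum_pow_mul_le hiss.ρ_pos hiss.ρ_lt_one (subopt_nonneg l x₀) T)
      (mul_nonneg hiss.cw_pos.le (norm_nonneg _))
  have hstage : ∀ k, |D.stageCost (D.xSub l x₀ k) (D.uSub l x₀ k) -
      D.stageCost (D.xStar x₀ k) (D.muStar (D.xStar x₀ k))| ≤
      (Mu * D.L + Mx) * e k + Mu * d k := by
    intro k
    have h1 := (hLip _ (hS k) _ (hD.muStar_mem_Sig hβ (hstar k))).1
    have h2 := norm_sub_le_norm_sub_add_norm_sub (D.uSub l x₀ k) (D.muStar (D.xSub l x₀ k))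
      (D.muStar (D.xStar x₀ k))
    have h3 := hD.norm_muStar_sub_le (D.xSub l x₀ k) (D.xStar x₀ k)
    refine h1.trans ?_
    have h4 := mul_le_mul_of_nonneg_left (h2.trans (add_le_add_right h3 _)) hMu.le
    have h5 : d k = ‖D.uSub l x₀ k - D.muStar (D.xSub l x₀ k)‖ := rfl
    rw [h5]
    simp only [he]
    linarith
  have hterm := (hLip _ (hS T) _ (hD.muStar_mem_Sig hβ (hstar T))).2
  rw [gap_eq]
  refine (abs_add_le _ _).trans ?_
  have h1 := (Finset.abs_sum_le_sum_abs (fun k => D.stageCost (D.xSub l x₀ k) (D.uSub l x₀ k) -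
    D.stageCost (D.xStar x₀ k) (D.muStar (D.xStar x₀ k))) (Finset.range T)).trans
    (Finset.sum_le_sum fun k _ => hstage k)
  rw [Finset.sum_add_distrib, ← Finset.mul_sum, ← Finset.mul_sum] at h1
  -- Enlarging the terminal weight to that of the stages absorbs it as the last term of a sum over
  -- `T + 1` times.
  have h2 : Mx * e T ≤ (Mu * D.L + Mx) * e T :=
    mul_le_mul_of_nonneg_right (le_add_of_nonneg_left (mul_nonneg hMu.le hL)) (he0 T)
  have h3 := mul_le_mul_of_nonneg_left hsum (show 0 ≤ Mu * D.L + Mx by positivity)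
  rw [Finset.sum_range_succ, mul_add] at h3
  calc _ ≤ (Mu * D.L + Mx) * (cw * ‖D.Bbar‖ * ((∑ k ∈ Finset.range T, d k) / (1 - ρ))) +
        Mu * ∑ k ∈ Finset.range T, d k := by linarith
    _ = _ := by rw [Mbar]; ring

/-- The convention that the weight at time `T` is `0` makes the recursion valid also at `k + 1 = T`.
-/
lemma etaTilde_of_lt (l : ℕ → ℕ) {T k : ℕ} (h : k < T) :
    D.etaTilde l T k = D.eta ^ l k * (1 + D.etaTilde l T (k + 1)) := by
  obtain ⟨r, rfl⟩ := Nat.exists_eq_add_of_lt h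
  have h1 : k + r + 1 - k = r + 1 := by omega
  have h2 : k + r + 1 - (k + 1) = r := by omega
  simp [etaTilde, etaAux, h1, h2]

lemma WellPosed.etaAux_nonneg (hD : D.WellPosed) (l : ℕ → ℕ) (r k : ℕ) : 0 ≤ D.etaAux l r k := by
  induction r generalizing k with
  | zero => exact le_rfl
  | succ r ih => exact mul_nonneg (pow_nonneg hD.eta_nonneg _) (by linarith [ih (k + 1)])

lemma WellPosed.etaTilde_nonneg (hD : D.WellPosed) (l : ℕ → ℕ) (T k : ℕ) :
    0 ≤ D.etaTilde l T k := hD.etaAux_nonneg l _ k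

/-- `q / (1 - q)` is the fixed point of `s ↦ q (1 + s)`. -/
lemma WellPosed.etaAux_le (hD : D.WellPosed) {l : ℕ → ℕ} {q : ℝ} (hq1 : q < 1)
    (h : ∀ k, D.eta ^ l k ≤ q) (r k : ℕ) : D.etaAux l r k ≤ q / (1 - q) := by
  have hq0 : 0 ≤ q := (pow_nonneg hD.eta_nonneg _).trans (h 0)
  have hq : 0 < 1 - q := by linarith
  induction r generalizing k with
  | zero => exact div_nonneg hq0 hq.le
  | succ r ih =>
    have h1 := hD.etaAux_nonneg l r (k + 1)
    calc _ ≤ q * (1 + q / (1 - q)) :=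
          mul_le_mul (h k) (by linarith [ih (k + 1)]) (by linarith) hq0
      _ = _ := by field_simp; ring

lemma etaTilde_le_etaBar (l : ℕ → ℕ) {T k : ℕ}
    (hk : k ∈ Finset.Ico 1 T) : D.etaTilde l T k ≤ D.etaBar l T :=
  Real.le_sqrt_of_sq_le (Finset.single_le_sum (f := fun k => D.etaTilde l T k ^ 2)
    (fun _ _ => sq_nonneg _) hk)

/-- Backward induction from the horizon: `η̃_{k+1}` is the total weight with which the error at time
`k` enters all later errors, and each state increment enters with the weight of its own time. -/
lemma WellPosed.sum_Ico_subopt_le (hD : D.WellPosed) (l : ℕ → ℕ) (x₀ : Vec (Fin n)) (T r k : ℕ)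
    (h : k + 1 + r = T) :
    ∑ j ∈ Finset.Ico (k + 1) T, D.subopt l x₀ j ≤ D.etaTilde l T (k + 1) * D.subopt l x₀ k +
      D.L * ∑ j ∈ Finset.Ico (k + 1) T,
        ‖D.xSub l x₀ j - D.xSub l x₀ (j - 1)‖ * D.etaTilde l T j := by
  induction r generalizing k with
  | zero =>
    rw [← h]
    simpa using mul_nonneg (hD.etaTilde_nonneg l _ _) (subopt_nonneg l x₀ k)
  | succ r ih =>
    have h1 := ih (k + 1) (by omega)
    have hlt : k + 1 < T := by omega
    rw [Finset.sum_eq_sum_Ico_succ_bot hlt, Finset.sum_eq_sum_Ico_succ_bot hlt,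
      add_tsub_cancel_right]
    have h2 := hD.subopt_succ_le l x₀ k
    have h3 := hD.etaTilde_nonneg l T (k + 1 + 1)
    have h4 := mul_le_mul_of_nonneg_left h2 (show 0 ≤ 1 + D.etaTilde l T (k + 1 + 1) by linarith)
    rw [etaTilde_of_lt l hlt]
    linarith

lemma WellPosed.sum_subopt_le (hD : D.WellPosed) (l : ℕ → ℕ) (x₀ : Vec (Fin n)) {T : ℕ}
    (hT : 1 ≤ T) :
    ∑ k ∈ Finset.range T, D.subopt l x₀ k ≤
      D.etaTilde l T 0 * ‖0 - D.muStar x₀‖ + D.L * D.pathTerm l T x₀ := by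
  have h1 := hD.sum_Ico_subopt_le l x₀ T (T - 1) 0 (by omega)
  rw [zero_add] at h1
  have h2 := mul_le_mul_of_nonneg_left (hD.subopt_zero_le l x₀)
    (show 0 ≤ 1 + D.etaTilde l T 1 by linarith [hD.etaTilde_nonneg l T 1])
  rw [Finset.range_eq_Ico, Finset.sum_eq_sum_Ico_succ_bot hT, etaTilde_of_lt l hT, zero_add,
    pathTerm]
  linarith

/-! ### Orders of the gap -/

/-- The common bound `b` on the weights is left free: it becomes `η̄` for general sequences and `η^ℓ
/ (1 - η^ℓ)` for constant ones. -/
lemma WellPosed.exists_abs_gap_le (hD : D.WellPosed) (hN : 1 ≤ N) {c β : ℝ} (hc : D.IsLevel c)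
    (hβ : D.IsDecayRate c β) :
    ∃ C, 0 ≤ C ∧ ∀ l : ℕ → ℕ, (∀ k, D.lStar β < l k) →
      ∀ x₀, (x₀, D.uSub l x₀ 0) ∈ D.Sig c β → ∀ T, 1 ≤ T →
        ∀ b, (∀ k ∈ Finset.Ico 1 T, D.etaTilde l T k ≤ b) → 0 ≤ b →
          |D.gap l T x₀| ≤ C * ((D.etaTilde l T 0 + b) * ‖x₀‖) := by
  obtain ⟨c₀, cw, rw, ρ, Mx, Mu, hiss, hrw, hM⟩ := hD.exists_admissible hN hc hβ
  obtain ⟨C, hC, hpath⟩ := hD.exists_sum_norm_xSub_sub_le hN hβ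
  have hMb := D.Mbar_nonneg hiss.cw_pos hiss.ρ_lt_one hM.1 hM.2.1
  have hL := D.L_nonneg
  refine ⟨D.Mbar cw ρ Mx Mu * (D.L * (1 + C)), by positivity,
    fun l hl x₀ hx₀ T hT b hb hb0 => ?_⟩
  refine (hD.abs_gap_le_sum hN hβ hiss hrw hM hl hx₀ T).trans ?_
  rw [mul_assoc]
  refine mul_le_mul_of_nonneg_left ((hD.sum_subopt_le l x₀ hT).trans ?_) hMb
  have h0 := hD.etaTilde_nonneg l T 0
  have h1 : D.etaTilde l T 0 * ‖0 - D.muStar x₀‖ ≤ D.etaTilde l T 0 * (D.L * ‖x₀‖) := by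
    rw [zero_sub, norm_neg]
    exact mul_le_mul_of_nonneg_left (hD.norm_muStar_le x₀) h0
  have h2 : D.pathTerm l T x₀ ≤ C * ‖x₀‖ * b := by
    refine le_trans ?_ (mul_le_mul_of_nonneg_right (hpath l hl x₀ hx₀ T) hb0)
    rw [pathTerm, Finset.sum_mul]
    exact Finset.sum_le_sum fun k hk => mul_le_mul_of_nonneg_left (hb k hk) (norm_nonneg _)
  have h3 := mul_le_mul_of_nonneg_left h2 hL
  have h4 : 0 ≤ D.etaTilde l T 0 * (D.L * C * ‖x₀‖) := by positivity
  have h5 : 0 ≤ b * (D.L * ‖x₀‖) := by positivity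
  calc _ ≤ D.etaTilde l T 0 * (D.L * ‖x₀‖) + D.L * (C * ‖x₀‖ * b) +
        (D.etaTilde l T 0 * (D.L * C * ‖x₀‖) + b * (D.L * ‖x₀‖)) := by linarith
    _ = _ := by ring

lemma WellPosed.etaTilde_zero_le (hD : D.WellPosed) {l : ℕ → ℕ} (hl : ∀ k, 1 ≤ l k) {p : ℕ}
    (hp : l 1 ≤ l 0 + p) {T : ℕ} (hT : 2 ≤ T) :
    D.etaTilde l T 0 ≤ 1 / (D.eta ^ p * (1 - D.eta)) * D.etaTilde l T 1 := by
  have hη0 := hD.eta_nonneg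
  have hη1 := hD.eta_lt_one
  have hη : 0 < 1 - D.eta := by linarith
  have h1 := hD.etaTilde_nonneg l T 1
  rw [etaTilde_of_lt l (show 0 < T by omega), zero_add]
  -- If `η = 0` the weight at time `0` vanishes, since `ℓ₀ ≥ 1`. Otherwise `η^{ℓ₀} η^p ≤ η^{ℓ₁} ≤
  -- η̃₁`, and `1 + η̃₁ ≤ 1 / (1 - η)`.
  rcases hη0.eq_or_lt with h0 | h0
  · have h2 := hl 0
    rw [← h0, zero_pow (by omega), zero_mul]
    positivity
  · have h2 : D.etaTilde l T 1 ≤ D.eta / (1 - D.eta) :=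
      hD.etaAux_le hη1 (fun k => by
        simpa using pow_le_pow_of_le_one hη0 hη1.le (hl k)) _ _
    have h3 : D.eta ^ l 0 * D.eta ^ p ≤ D.etaTilde l T 1 := by
      rw [etaTilde_of_lt l (show 1 < T by omega), ← pow_add]
      refine (pow_le_pow_of_le_one hη0 hη1.le hp).trans (le_mul_of_one_le_right (by positivity) ?_)
      linarith [hD.etaTilde_nonneg l T (1 + 1)]
    have h4 : 1 + D.etaTilde l T 1 ≤ 1 / (1 - D.eta) := by
      have : 1 / (1 - D.eta) = 1 + D.eta / (1 - D.eta) := by field_simp; ring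
      linarith
    have h5 : D.eta ^ l 0 ≤ D.etaTilde l T 1 / D.eta ^ p := by
      rwa [le_div_iff₀ (by positivity)]
    calc _ ≤ D.etaTilde l T 1 / D.eta ^ p * (1 / (1 - D.eta)) :=
          mul_le_mul h5 h4 (by linarith) (by positivity)
      _ = _ := by field_simp

end Data

end LQMPC

end

theorem mainTheorem6 {n m N : ℕ} (hN : 1 ≤ N) (D : LQMPC.Data n m N) (hD : D.WellPosed)
    (c : ℝ) (hc : D.IsLevel c) :
    (∃ β, D.IsDecayRate c β) ∧
    ∀ β, D.IsDecayRate c β →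
      -- the constants entering the explicit bound exist ...
      (∃ c₀ cw rw ρ Mx Mu, LQMPC.IsEDeltaISS D.f (D.Gam c) c₀ cw rw ρ ∧
        (∀ p ∈ D.Sig c β, ‖LQMPC.act D.Bbar (p.2 - D.muStar p.1)‖ ≤ rw) ∧
        D.IsCostLipschitz (D.Sig c β) Mx Mu) ∧
      -- ... and the explicit bound holds with any such constants
      (∀ c₀ cw rw ρ Mx Mu, LQMPC.IsEDeltaISS D.f (D.Gam c) c₀ cw rw ρ →
        (∀ p ∈ D.Sig c β, ‖LQMPC.act D.Bbar (p.2 - D.muStar p.1)‖ ≤ rw) →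
        D.IsCostLipschitz (D.Sig c β) Mx Mu →
        ∀ l : ℕ → ℕ, (∀ k, D.lStar β < l k) →
        ∀ x₀, (x₀, D.uSub l x₀ 0) ∈ D.Sig c β → ∀ T, 1 ≤ T →
          D.gap l T x₀ ≤ D.Mbar cw ρ Mx Mu *
            (D.etaTilde l T 0 * ‖0 - D.muStar x₀‖ + D.L * D.pathTerm l T x₀)) ∧
      -- order of the gap, uniformly in the iteration numbers, the initial state and the horizon
      (∃ C : ℝ, ∀ l : ℕ → ℕ, (∀ k, D.lStar β < l k) →
        ∀ x₀, (x₀, D.uSub l x₀ 0) ∈ D.Sig c β → ∀ T, 1 ≤ T →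
          |D.gap l T x₀| ≤ C * ((D.etaTilde l T 0 + D.etaBar l T) * ‖x₀‖)) ∧
      -- order of the gap in terms of `η̄` alone
      (∀ p : ℕ, ∃ C : ℝ, ∀ l : ℕ → ℕ, (∀ k, D.lStar β < l k) → l 1 ≤ l 0 + p →
        ∀ x₀, (x₀, D.uSub l x₀ 0) ∈ D.Sig c β → ∀ T, 2 ≤ T →
          |D.gap l T x₀| ≤ C * (D.etaBar l T * ‖x₀‖)) ∧
      -- constant number of iterations
      (∃ C : ℝ, ∀ l : ℕ, D.lStar β < l →
        ∀ x₀, (x₀, D.uSub (fun _ => l) x₀ 0) ∈ D.Sig c β → ∀ T, 1 ≤ T →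
          |D.gap (fun _ => l) T x₀| ≤ C * (D.eta ^ l / (1 - D.eta ^ l) * ‖x₀‖)) := by
  refine ⟨hD.exists_isDecayRate hN hc, fun β hβ => ⟨hD.exists_admissible hN hc hβ, ?_, ?_, ?_, ?_⟩⟩
  · intro c₀ cw rw ρ Mx Mu hiss hrw hM l hl x₀ hx₀ T hT
    exact (le_abs_self _).trans ((hD.abs_gap_le_sum hN hβ hiss hrw hM hl hx₀ T).trans
      (mul_le_mul_of_nonneg_left (hD.sum_subopt_le l x₀ hT)
        (LQMPC.Data.Mbar_nonneg hiss.cw_pos hiss.ρ_lt_one hM.1 hM.2.1)))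
  · obtain ⟨C, -, h⟩ := hD.exists_abs_gap_le hN hc hβ
    exact ⟨C, fun l hl x₀ hx₀ T hT => h l hl x₀ hx₀ T hT _
      (fun k hk => LQMPC.Data.etaTilde_le_etaBar l hk) (Real.sqrt_nonneg _)⟩
  · intro p
    obtain ⟨C, hC, h⟩ := hD.exists_abs_gap_le hN hc hβ
    obtain ⟨q, -, -, hq⟩ := hD.exists_contraction_bound hβ
    refine ⟨C * (1 / (D.eta ^ p * (1 - D.eta)) + 1), fun l hl hp x₀ hx₀ T hT => ?_⟩
    have hη : 0 < 1 - D.eta := by linarith [hD.eta_lt_one]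
    have hη0 := hD.eta_nonneg
    have h1 := h l hl x₀ hx₀ T (by omega) _
      (fun k hk => LQMPC.Data.etaTilde_le_etaBar l hk) (Real.sqrt_nonneg _)
    have h2 : D.etaTilde l T 0 ≤ 1 / (D.eta ^ p * (1 - D.eta)) * D.etaBar l T :=
      (hD.etaTilde_zero_le (fun k => (hq _ (hl k)).1) hp hT).trans
        (mul_le_mul_of_nonneg_left
          (LQMPC.Data.etaTilde_le_etaBar l (Finset.mem_Ico.2 ⟨le_rfl, hT⟩)) (by positivity))
    refine h1.trans ?_
    rw [mul_assoc]
    refine mul_le_mul_of_nonneg_left ?_ hC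
    rw [← mul_assoc]
    exact mul_le_mul_of_nonneg_right (by linarith) (norm_nonneg _)
  · obtain ⟨C, hC, h⟩ := hD.exists_abs_gap_le hN hc hβ
    obtain ⟨q, -, -, hq⟩ := hD.exists_contraction_bound hβ
    -- The factor `2` arises because the weight at time `0` and the common bound on the later ones
    -- are both at most `η^ℓ / (1 - η^ℓ)`.
    refine ⟨C * 2, fun l hl x₀ hx₀ T hT => ?_⟩
    have hl1 : D.eta ^ l < 1 := pow_lt_one₀ hD.eta_nonneg hD.eta_lt_one
      (by have := (hq l hl).1; omega)
    have hb : ∀ k, D.etaTilde (fun _ => l) T k ≤ D.eta ^ l / (1 - D.eta ^ l) :=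
      fun k => hD.etaAux_le hl1 (fun _ => le_rfl) _ k
    have hb0 : 0 ≤ D.eta ^ l / (1 - D.eta ^ l) :=
      (hD.etaTilde_nonneg _ T 0).trans (hb 0)
    refine (h _ (fun _ => hl) x₀ hx₀ T hT _ (fun k _ => hb k) hb0).trans ?_
    rw [mul_assoc]
    refine mul_le_mul_of_nonneg_left ?_ hC
    rw [← mul_assoc]
    exact mul_le_mul_of_nonneg_right (by linarith [hb 0]) (norm_nonneg _)
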